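/- Let $\mathbb{Y}$ be a Polish space with its Borel $\sigma$-algebra, $\mu$ a $\sigma$-finite measure on it, and let $\mathbb{F}$ be a set of probability densities with respect to $\mu$, carrying a $\sigma$-algebra for which $(f,y)\mapsto f(y)$ is jointly measurable. Let $\Pi$ be a probability measure (prior) on $\mathbb{F}$. Let $Y_1,Y_2,\ldots$ be iid with density $f^\star$ with respect to $\mu$, where $f^\star$ need not belong to $\mathbb{F}$, and let $\mathsf{P}$ be the underlying probability. With $K(f^\star,f)=\int \log(f^\star/f)\,f^\star\,d\mu$, let $f^\circ\in\mathbb{F}$ satisfy $K(f^\star,f^\circ)<\infty$ and $$K^\star(f^\circ,f):=K(f^\star,f)-K(f^\star,f^\circ)\ge 0\quad\text{for all } f\in\mathbb{F}.$$ Put $V^\star(f^\circ,f)=\int\{\log(f^\circ/f)\}^2 f^\star\,d\mu$ and $H^\star(f,g)^2=\int (f^{1/2}-g^{1/2})^2\,(f^\star/f^\circ)\,d\mu$. For $\delta>0$ and a set $A$ of densities, $N(\delta,A,H^\star)$ is the least number of $H^\star$-balls of radius $\delta$ that cover $A$. The posterior is $$\Pi_n(A)=\frac{\int_A R_n(f)\,\Pi(df)}{\int_{\mathbb{F}}R_n(f)\,\Pi(df)},\qquad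 R_n(f)=\prod_{i=1}^n \frac{f(Y_i)}{f^\circ(Y_i)}.$$ Assume that $\mathbb{F}$ is convex, i.e. for every probability measure $\Phi$ on $\mathbb{F}$ the mixture $\int f\,\Phi(df)$ belongs to $\mathbb{F}$ (up to $\mu$-a.e. equality). Let $(\varepsilon_n)$ be a positive sequence with $\varepsilon_n\to 0$ and $n\varepsilon_n^2\to\infty$, and let $C>0$ be such that, for all large $n$, $$\Pi(\{f: K^\star(f^\circ,f)\le\varepsilon_n^2,\ V^\star(f^\circ,f)\le\varepsilon_n^2\})\ge e^{-Cn\varepsilon_n^2}.$$ Suppose there are measurable sets $\mathbb{F}_n\subseteq\mathbb{F}$ and constants $r>C+1$, $D$ and $R$ such that, for all large $n$, $$\Pi(\mathbb{F}_n^c)\le D\,e^{-rn\varepsilon_n^2}\quad\text{and}\quad \log N(\varepsilon_n,\mathbb{F}_n,H^\star)\le R\,n\varepsilon_n^2 .$$ Then there is a constant $M>0$, depending only on $C$ and $R$, such that $$\Pi_n(\{f\in\mathbb{F}: H^\star(f^\circ,f)\ge M\varepsilon_n\})\to 0\quad\text{in } \mathsf{P}\text{-probability}.$$ -/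

import Mathlib

open MeasureTheory ProbabilityTheory Filter Topology InformationTheory
open scoped NNReal ENNReal

namespace Misspecified

/-- A probability density on `𝕐` with respect to the reference measure `μ`. -/
structure Density {𝕐 : Type*} [MeasurableSpace 𝕐] (μ : Measure 𝕐) where
  /-- the density function -/
  pdf : 𝕐 → ℝ≥0
  measurable_pdf : Measurable pdf
  lintegral_pdf : ∫⁻ y, (pdf y : ℝ≥0∞) ∂μ = 1

section

variable {𝕐 : Type*} [MeasurableSpace 𝕐] {μ : Measure 𝕐}

/-- The probability measure with density `f`. -/
noncomputable def Density.law (f : Density μ) : Measure 𝕐 :=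
  μ.withDensity fun y => (f.pdf y : ℝ≥0∞)

/-- The Kullback--Leibler contrast `K*(f₀, f) = K(f*, f) - K(f*, f₀)`, in the extended reals. -/
noncomputable def klContrast (fstar f₀ f : Density μ) : EReal :=
  (klDiv fstar.law f.law : EReal) - (klDiv fstar.law f₀.law : EReal)

/-- `f₀` is an element of the model `F` that minimises `f ↦ K(f*, f)` over `F`, the minimum
being finite. -/
def IsKLMinimizer (fstar : Density μ) (F : Set (Density μ)) (f₀ : Density μ) : Prop :=
  f₀ ∈ F ∧ klDiv fstar.law f₀.law ≠ ∞ ∧ ∀ f ∈ F, 0 ≤ klContrast fstar f₀ f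

/-- `V*(f₀, f) = ∫ {log (f₀ / f)}² f* dμ`, with the extended logarithm, so that the integrand
is `∞` where `f` vanishes and `f₀`, `f*` do not. -/
noncomputable def logSqContrast (fstar f₀ f : Density μ) : ℝ≥0∞ :=
  ∫⁻ y, (ENNReal.log ((f₀.pdf y : ℝ≥0∞) / (f.pdf y : ℝ≥0∞))).abs ^ 2 * (fstar.pdf y : ℝ≥0∞) ∂μ

/-- The weighted Hellinger distance
`H*(f, g) = {∫ (f^{1/2} - g^{1/2})² (f* / f₀) dμ}^{1/2}`. -/
noncomputable def hellingerStar (fstar f₀ f g : Density μ) : ℝ≥0∞ :=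
  (∫⁻ y, ENNReal.ofReal ((Real.sqrt (f.pdf y) - Real.sqrt (g.pdf y)) ^ 2)
    * ((fstar.pdf y / f₀.pdf y : ℝ≥0) : ℝ≥0∞) ∂μ) ^ (1 / 2 : ℝ)

theorem hellingerStar_eq_eLpNorm (fstar f₀ f g : Density μ) :
    hellingerStar fstar f₀ f g
      = eLpNorm (fun y => Real.sqrt (f.pdf y) - Real.sqrt (g.pdf y)) 2
          (μ.withDensity fun y => ((fstar.pdf y / f₀.pdf y : ℝ≥0) : ℝ≥0∞)) := by
  have h1 := f.measurable_pdf
  have h2 := g.measurable_pdf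
  have h3 := fstar.measurable_pdf
  have h4 := f₀.measurable_pdf
  rw [eLpNorm_eq_lintegral_rpow_enorm_toReal (by norm_num) (by norm_num),
    lintegral_withDensity_eq_lintegral_mul _ (by fun_prop) (by fun_prop)]
  simp only [hellingerStar, ENNReal.toReal_ofNat, Pi.mul_apply]
  congr 1
  refine lintegral_congr fun y => ?_
  rw [mul_comm]
  congr 1
  rw [Real.enorm_eq_ofReal_abs, ENNReal.ofReal_rpow_of_nonneg (abs_nonneg _) (by norm_num)]
  congr 1
  norm_num [sq_abs]

/-- `H*` makes the set of densities an (extended) pseudo-metric space. -/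
@[reducible] noncomputable def hellingerStarSpace (fstar f₀ : Density μ) :
    PseudoEMetricSpace (Density μ) where
  edist := hellingerStar fstar f₀
  edist_self f := by simp [hellingerStar]
  edist_comm f g := by
    simp only [hellingerStar]
    congr 1
    refine lintegral_congr fun y => ?_
    rw [← neg_sub, neg_sq]
  edist_triangle f g h := by
    have h1 := f.measurable_pdf
    have h2 := g.measurable_pdf
    have h3 := h.measurable_pdf
    simp only [hellingerStar_eq_eLpNorm]
    refine le_trans (le_of_eq ?_) (eLpNorm_add_le (μ := μ.withDensity fun y =>
      ((fstar.pdf y / f₀.pdf y : ℝ≥0) : ℝ≥0∞))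
      (f := fun y => Real.sqrt (f.pdf y) - Real.sqrt (g.pdf y))
      (g := fun y => Real.sqrt (g.pdf y) - Real.sqrt (h.pdf y)) ?_ ?_ (by norm_num))
    · congr 1
      funext y
      simp
    · exact Measurable.aestronglyMeasurable (by fun_prop)
    · exact Measurable.aestronglyMeasurable (by fun_prop)

/-- `N(δ, A, H*)`: the least number of `H*`-balls of radius `δ`, centred at densities,
that cover `A`. -/
noncomputable def hellingerStarCoveringNumber (fstar f₀ : Density μ) (δ : ℝ≥0)
    (A : Set (Density μ)) : ℕ∞ :=
  @Metric.externalCoveringNumber (Density μ) (hellingerStarSpace fstar f₀) δ A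

/-- `F` is convex: for every probability measure `Φ` on `F`, the mixture `∫ f Φ(df)` belongs
to `F` (densities being identified when they agree `μ`-almost everywhere). -/
def IsMixtureConvex (F : Set (Density μ)) [MeasurableSpace F] : Prop :=
  ∀ Φ : Measure F, IsProbabilityMeasure Φ →
    ∃ g ∈ F, ∀ᵐ y ∂μ, (g.pdf y : ℝ≥0∞) = ∫⁻ f : F, (f.1.pdf y : ℝ≥0∞) ∂Φ

/-- `R_n(f) = ∏_{i ≤ n} f(Y_i) / f₀(Y_i)`; the observations are numbered from `0`. -/
noncomputable def likelihoodRatio (f₀ f : Density μ) (n : ℕ) (y : ℕ → 𝕐) : ℝ≥0 :=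
  ∏ i ∈ Finset.range n, f.pdf (y i) / f₀.pdf (y i)

/-- The posterior probability `Π_n(A) = ∫_A R_n(f) Π(df) / ∫_F R_n(f) Π(df)` given the first
`n` observations of the sequence `y`. -/
noncomputable def posterior {F : Set (Density μ)} [MeasurableSpace F] (prior : Measure F)
    (f₀ : Density μ) (n : ℕ) (y : ℕ → 𝕐) (A : Set F) : ℝ≥0∞ :=
  (∫⁻ f in A, (likelihoodRatio f₀ f.1 n y : ℝ≥0∞) ∂prior)
    / ∫⁻ f, (likelihoodRatio f₀ f.1 n y : ℝ≥0∞) ∂prior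

/-- The prior mass condition for `ε_n`-thickness at `f₀` with constant `C` (for all large `n`):
`Π{f : K*(f₀, f) ≤ ε_n², V*(f₀, f) ≤ ε_n²} ≥ exp(-C n ε_n²)`. -/
def IsThick {F : Set (Density μ)} [MeasurableSpace F] (prior : Measure F)
    (fstar f₀ : Density μ) (ε : ℕ → ℝ) (C : ℝ) : Prop :=
  ∀ᶠ n : ℕ in atTop,
    ENNReal.ofReal (Real.exp (-C * (n * ε n ^ 2))) ≤
      prior {f : F | klContrast fstar f₀ f.1 ≤ ((ε n ^ 2 : ℝ) : EReal) ∧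
        logSqContrast fstar f₀ f.1 ≤ ENNReal.ofReal (ε n ^ 2)}

end

end Misspecified

/-!
The proof runs on square roots of integrated likelihoods, so that neither tests nor a minimax theorem
are needed.

Convexity enters three times. First, `f₀` minimises `K(f*, ·)` over a convex set, and the first-order
condition along segments is `∫ (f / f₀) f* dμ ≤ 1` for all `f` in the model (`lintegral_div_le_one`);
expanding the square in `H*` turns this into the affinity bound
`∫ (f / f₀)^{1/2} f* dμ ≤ 1 - H*(f₀, f)² / 2` (`affinity_add_hellingerStar_sq_le`). Second,
`f ↦ H*(f, g)²` is convex, so a mixture of densities in an `H*`-ball stays in that ball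
(`hellingerStar_mixture_le`). Third, the mixture is itself in the model, so the affinity bound applies
to it. Given the first `n` observations, the integrated likelihood of a set after one more
observation is its current value times the ratio at the new observation of such a mixture to `f₀`.
Hence for a subset `A` of a ball at distance at least `d` from `f₀`, the expectation of
`(∫_A R_n dΠ)^{1/2}` is at most `exp (-n d² / 2)`
(`lintegral_sqrt_lintegral_likelihoodRatio_le`, `lintegral_sqrt_likelihoodRatio_ball_le`), while for
an arbitrary set it is at most `Π(A)^{1/2}`.

The evidence `∫ R_n dΠ` is at least `exp (-(1 + c + C) n ε_n²) / 2` with probability tending to one: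
each density of the Kullback--Leibler neighbourhood has likelihood ratio at least
`exp (-(1 + c) n ε_n²)` outside an event of small probability, by Chebyshev's inequality, and Tonelli
and Markov transfer this to half of the prior mass of the neighbourhood (`measure_evidence_lt_le`).

Since posterior probabilities are at most one, they are at most their own square roots. Summing over a
cover of the sieve by balls and over the complement of the sieve gives `measure_posterior_ge_le`, and
the theorem follows by comparing exponents.
-/

namespace Misspecified

/-! ### Weighted Hellinger geometry -/

section Hellinger

variable {𝕐 : Type*} [MeasurableSpace 𝕐] {μ : Measure 𝕐}

attribute [fun_prop] Density.measurable_pdf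

instance Density.isProbabilityMeasure_law (f : Density μ) : IsProbabilityMeasure f.law :=
  ⟨by simp [Density.law, f.lintegral_pdf]⟩

lemma Density.lintegral_law (f : Density μ) {g : 𝕐 → ℝ≥0∞} (hg : Measurable g) :
    ∫⁻ y, g y ∂f.law = ∫⁻ y, (f.pdf y : ℝ≥0∞) * g y ∂μ := by
  rw [Density.law, lintegral_withDensity_eq_lintegral_mul _ (by fun_prop) hg]
  rfl

lemma Density.pdf_ne_zero_ae_law (f : Density μ) : ∀ᵐ y ∂f.law, f.pdf y ≠ 0 := by
  rw [Density.law, ae_withDensity_iff (by fun_prop)]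
  filter_upwards with y hy
  simpa using hy

lemma hellingerStar_sq (fstar f₀ f g : Density μ) :
    hellingerStar fstar f₀ f g ^ 2 =
      ∫⁻ y, ENNReal.ofReal ((Real.sqrt (f.pdf y) - Real.sqrt (g.pdf y)) ^ 2)
        * ((fstar.pdf y / f₀.pdf y : ℝ≥0) : ℝ≥0∞) ∂μ := by
  rw [hellingerStar, ← ENNReal.rpow_natCast, ← ENNReal.rpow_mul]
  norm_num

/-- If `∫ (f / f₀) f* dμ ≤ 1`, then expanding the square in `H*(f₀, f)²` bounds the weighted
Hellinger affinity: `∫ (f / f₀)^{1/2} f* dμ ≤ 1 - H*(f₀, f)² / 2`. -/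
lemma affinity_add_hellingerStar_sq_le (fstar f₀ f : Density μ)
    (hf : ∫⁻ y, ((f.pdf y / f₀.pdf y : ℝ≥0) : ℝ≥0∞) ∂fstar.law ≤ 1) :
    2 * ∫⁻ y, ((f.pdf y / f₀.pdf y : ℝ≥0) : ℝ≥0∞) ^ (1 / 2 : ℝ) ∂fstar.law
      + hellingerStar fstar f₀ f₀ f ^ 2 ≤ 2 := by
  rw [hellingerStar_sq, fstar.lintegral_law (by fun_prop), ← lintegral_const_mul _ (by fun_prop),
    ← lintegral_add_left (by fun_prop)]
  rw [fstar.lintegral_law (by fun_prop)] at hf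
  calc _ ≤ ∫⁻ y, ((fstar.pdf y : ℝ≥0∞)
          + (fstar.pdf y : ℝ≥0∞) * ((f.pdf y / f₀.pdf y : ℝ≥0) : ℝ≥0∞)) ∂μ := by
        refine lintegral_mono fun y => ?_
        set a := f₀.pdf y
        set b := f.pdf y
        set c := fstar.pdf y
        rw [← ENNReal.coe_rpow_of_nonneg _ (by norm_num), ENNReal.ofReal,
          ← NNReal.sqrt_eq_rpow]
        have key : 2 * (c * NNReal.sqrt (b / a))
            + ((Real.sqrt a - Real.sqrt b) ^ 2).toNNReal * (c / a) ≤ c + c * (b / a) := by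
          rw [← NNReal.coe_le_coe]
          push_cast
          rw [Real.coe_toNNReal _ (sq_nonneg _)]
          rcases eq_or_ne a 0 with ha | ha
          · simp [ha]
          · have ha' : (0 : ℝ) < a := by positivity
            rw [Real.sqrt_div (by positivity)]
            have h1 := Real.sq_sqrt ha'.le
            have h2 := Real.sq_sqrt (NNReal.coe_nonneg b)
            have hs : 0 < Real.sqrt a := Real.sqrt_pos.2 ha'
            set s := Real.sqrt a
            set t := Real.sqrt b
            rw [← h1, ← h2]
            apply le_of_eq
            field_simp
            ring
        simpa only [ENNReal.coe_add, ENNReal.coe_mul, ENNReal.coe_ofNat] using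
          ENNReal.coe_le_coe.2 key
    _ ≤ 2 := by
        rw [lintegral_add_left (by fun_prop), fstar.lintegral_pdf]
        calc _ ≤ (1 : ℝ≥0∞) + 1 := by gcongr
          _ = 2 := by norm_num

/-- The triangle inequality in `L²(Φ)`, comparing the random variable `√u` with the constant `√b`. -/
lemma ofReal_sqrt_sub_sqrt_sq_le {α : Type*} [MeasurableSpace α] (Φ : Measure α)
    [IsProbabilityMeasure Φ] {u : α → ℝ≥0} (hu : Measurable u) {a b : ℝ≥0}
    (ha : (a : ℝ≥0∞) = ∫⁻ x, (u x : ℝ≥0∞) ∂Φ) :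
    ENNReal.ofReal ((Real.sqrt a - Real.sqrt b) ^ 2) ≤
      ∫⁻ x, ENNReal.ofReal ((Real.sqrt (u x) - Real.sqrt b) ^ 2) ∂Φ := by
  have hsq : ∀ v : α → ℝ, eLpNorm v 2 Φ ^ 2 = ∫⁻ x, ENNReal.ofReal (v x ^ 2) ∂Φ := by
    intro v
    rw [eLpNorm_eq_lintegral_rpow_enorm_toReal (by norm_num) (by norm_num),
      ← ENNReal.rpow_natCast, ← ENNReal.rpow_mul]
    norm_num
    refine lintegral_congr fun x => ?_
    rw [Real.enorm_eq_ofReal_abs, ← ENNReal.ofReal_pow (abs_nonneg _), sq_abs]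
  have hroot : ∀ {w : ℝ≥0} {v : α → ℝ}, ∫⁻ x, ENNReal.ofReal (v x ^ 2) ∂Φ = w →
      eLpNorm v 2 Φ = ENNReal.ofReal (Real.sqrt w) := by
    intro w v h
    rw [← hsq] at h
    have : (ENNReal.ofReal (Real.sqrt w)) ^ 2 = w := by
      rw [← ENNReal.ofReal_pow (Real.sqrt_nonneg _), Real.sq_sqrt (by positivity)]
      simp
    exact (ENNReal.pow_right_strictMono two_ne_zero).injective (h.trans this.symm)
  have hA := hroot (w := a) (v := fun x => Real.sqrt (u x)) (by
    rw [ha]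
    refine lintegral_congr fun x => ?_
    rw [Real.sq_sqrt (by positivity)]
    simp)
  have hB := hroot (w := b) (v := fun _ : α => Real.sqrt b) (by
    rw [Real.sq_sqrt (by positivity)]
    simp)
  rw [← hsq]
  generalize hN : eLpNorm (fun x => Real.sqrt (u x) - Real.sqrt b) 2 Φ = N
  have m1 : AEStronglyMeasurable (fun x => Real.sqrt (u x)) Φ :=
    Measurable.aestronglyMeasurable (by fun_prop)
  have m2 : AEStronglyMeasurable (fun _ : α => Real.sqrt b) Φ := aestronglyMeasurable_const
  have h1 : ENNReal.ofReal (Real.sqrt a) ≤ N + ENNReal.ofReal (Real.sqrt b) := by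
    rw [← hA, ← hB, ← hN]
    refine le_trans (le_of_eq ?_) (eLpNorm_add_le (m1.sub m2) m2 (by norm_num))
    congr 1
    funext x
    simp
  have h2 : ENNReal.ofReal (Real.sqrt b) ≤ N + ENNReal.ofReal (Real.sqrt a) := by
    rw [← hA, ← hB, ← hN]
    have := eLpNorm_sub_le m1 (m1.sub m2) (p := 2) (by norm_num)
    rw [add_comm]
    refine le_trans (le_of_eq ?_) this
    congr 1
    funext x
    simp
  clear hN
  rcases eq_or_ne N ∞ with hN' | hN'
  · simp [hN']
  lift N to ℝ≥0 using hN'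
  rw [← ENNReal.ofReal_coe_nnreal, ← ENNReal.ofReal_add (by positivity) (by positivity),
    ENNReal.ofReal_le_ofReal_iff (by positivity)] at h1 h2
  rw [← ENNReal.ofReal_coe_nnreal, ← ENNReal.ofReal_pow (by positivity)]
  apply ENNReal.ofReal_le_ofReal
  exact sq_le_sq' (by linarith) (by linarith)

lemma measurable_hellingerStar [SFinite μ] {F : Set (Density μ)} [MeasurableSpace F]
    (hF : Measurable fun q : F × 𝕐 => q.1.1.pdf q.2) (fstar f₀ g : Density μ) :
    Measurable fun f : F => hellingerStar fstar f₀ f.1 g := by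
  unfold hellingerStar
  refine Measurable.pow_const ?_ _
  refine Measurable.lintegral_prod_right'
    (f := fun q : F × 𝕐 => ENNReal.ofReal ((Real.sqrt (q.1.1.pdf q.2) - Real.sqrt (g.pdf q.2)) ^ 2)
    * ((fstar.pdf q.2 / f₀.pdf q.2 : ℝ≥0) : ℝ≥0∞)) ?_
  fun_prop

lemma hellingerStar_comm (fstar f₀ f g : Density μ) :
    hellingerStar fstar f₀ f g = hellingerStar fstar f₀ g f :=
  (hellingerStarSpace fstar f₀).edist_comm f g

lemma hellingerStar_triangle (fstar f₀ f g h : Density μ) :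
    hellingerStar fstar f₀ f h ≤ hellingerStar fstar f₀ f g + hellingerStar fstar f₀ g h :=
  (hellingerStarSpace fstar f₀).edist_triangle f g h

/-- `H*`-balls are convex: a mixture of densities in the closed ball of radius `δ` around `g`
lies in that ball. -/
lemma hellingerStar_mixture_le [SFinite μ] {F : Set (Density μ)} [MeasurableSpace F]
    (hF : Measurable fun q : F × 𝕐 => q.1.1.pdf q.2) (fstar f₀ g : Density μ)
    (Φ : Measure F) [IsProbabilityMeasure Φ] {δ : ℝ≥0∞}
    (hΦ : ∀ᵐ f : F ∂Φ, hellingerStar fstar f₀ f.1 g ≤ δ) {h : Density μ}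
    (hh : ∀ᵐ y ∂μ, (h.pdf y : ℝ≥0∞) = ∫⁻ f : F, (f.1.pdf y : ℝ≥0∞) ∂Φ) :
    hellingerStar fstar f₀ h g ≤ δ := by
  rw [← ENNReal.pow_le_pow_left_iff two_ne_zero, hellingerStar_sq]
  calc _ ≤ ∫⁻ y, ∫⁻ f : F, ENNReal.ofReal ((Real.sqrt (f.1.pdf y) - Real.sqrt (g.pdf y)) ^ 2)
            * ((fstar.pdf y / f₀.pdf y : ℝ≥0) : ℝ≥0∞) ∂Φ ∂μ := by
        refine lintegral_mono_ae ?_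
        filter_upwards [hh] with y hy
        have hm : Measurable fun f : F => f.1.pdf y := hF.comp measurable_prodMk_right
        rw [lintegral_mul_const _ (by fun_prop)]
        gcongr
        exact ofReal_sqrt_sub_sqrt_sq_le Φ hm hy
    _ = ∫⁻ f : F, hellingerStar fstar f₀ f.1 g ^ 2 ∂Φ := by
        rw [lintegral_lintegral_swap]
        · simp only [hellingerStar_sq]
        · refine Measurable.aemeasurable ?_
          have : Measurable fun q : 𝕐 × F => q.2.1.pdf q.1 := hF.comp measurable_swap
          unfold Function.uncurry
          fun_prop
    _ ≤ ∫⁻ _ : F, δ ^ 2 ∂Φ := by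
        refine lintegral_mono_ae ?_
        filter_upwards [hΦ] with f hf
        gcongr
    _ = δ ^ 2 := by simp

end Hellinger

/-! ### The Kullback--Leibler minimiser and the prior neighbourhood -/

section KullbackLeibler

variable {𝕐 : Type*} [MeasurableSpace 𝕐] {μ : Measure 𝕐}

lemma law_eq_withDensity_div {fstar f : Density μ} (hf : ∀ᵐ y ∂fstar.law, f.pdf y ≠ 0) :
    fstar.law = f.law.withDensity fun y => ((fstar.pdf y / f.pdf y : ℝ≥0) : ℝ≥0∞) := by
  rw [Density.law, Density.law, ← withDensity_mul _ (by fun_prop) (by fun_prop)]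
  rw [Density.law, ae_withDensity_iff (by fun_prop)] at hf
  refine withDensity_congr_ae ?_
  filter_upwards [hf] with y hy
  rcases eq_or_ne (fstar.pdf y) 0 with h | h
  · simp [h]
  · rw [Pi.mul_apply, ← ENNReal.coe_mul, mul_div_cancel₀ _ (hy (by simpa using h))]

lemma law_absolutelyContinuous_iff {fstar f : Density μ} :
    fstar.law ≪ f.law ↔ ∀ᵐ y ∂fstar.law, f.pdf y ≠ 0 := by
  refine ⟨fun h => h.ae_le f.pdf_ne_zero_ae_law, fun h => ?_⟩
  rw [law_eq_withDensity_div h]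
  exact withDensity_absolutelyContinuous _ _

lemma llr_law {fstar f : Density μ} (hf : ∀ᵐ y ∂fstar.law, f.pdf y ≠ 0) :
    llr fstar.law f.law =ᵐ[fstar.law] fun y => Real.log (fstar.pdf y / f.pdf y) := by
  have hac := law_absolutelyContinuous_iff.2 hf
  refine hac.ae_le ?_
  have h := Measure.rnDeriv_withDensity f.law
    (f := fun y => ((fstar.pdf y / f.pdf y : ℝ≥0) : ℝ≥0∞)) (by fun_prop)
  rw [← law_eq_withDensity_div hf] at h
  filter_upwards [h] with y hy
  simp [llr, hy]

lemma klDiv_law_ne_top_iff {fstar f : Density μ} :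
    klDiv fstar.law f.law ≠ ∞ ↔ (∀ᵐ y ∂fstar.law, f.pdf y ≠ 0) ∧
      Integrable (fun y => Real.log (fstar.pdf y / f.pdf y)) fstar.law := by
  rw [klDiv_ne_top_iff, law_absolutelyContinuous_iff]
  exact and_congr_right fun h => integrable_congr (llr_law h)

lemma toReal_klDiv_law {fstar f : Density μ} (hf : ∀ᵐ y ∂fstar.law, f.pdf y ≠ 0) :
    (klDiv fstar.law f.law).toReal = ∫ y, Real.log (fstar.pdf y / f.pdf y) ∂fstar.law := by
  rw [toReal_klDiv_of_measure_eq (law_absolutelyContinuous_iff.2 hf) (by simp)]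
  exact integral_congr_ae (llr_law hf)

/-- Whenever `log (f₀ / f)` is integrable under the true law, `K*(f₀, f) = ∫ log (f₀ / f) f* dμ`. -/
lemma klContrast_eq_integral {fstar f₀ f : Density μ} (hf₀ : klDiv fstar.law f₀.law ≠ ∞)
    (hf : ∀ᵐ y ∂fstar.law, f.pdf y ≠ 0)
    (hint : Integrable (fun y => Real.log (f₀.pdf y / f.pdf y)) fstar.law) :
    klContrast fstar f₀ f = ((∫ y, Real.log (f₀.pdf y / f.pdf y) ∂fstar.law : ℝ) : EReal) := by
  obtain ⟨h₀, hint₀⟩ := klDiv_law_ne_top_iff.1 hf₀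
  have hadd : (fun y => Real.log (fstar.pdf y / f.pdf y)) =ᵐ[fstar.law]
      fun y => Real.log (fstar.pdf y / f₀.pdf y) + Real.log (f₀.pdf y / f.pdf y) := by
    filter_upwards [h₀, hf, fstar.pdf_ne_zero_ae_law] with y h1 h2 h3
    have h1' : (f₀.pdf y : ℝ) ≠ 0 := by exact_mod_cast h1
    have h2' : (f.pdf y : ℝ) ≠ 0 := by exact_mod_cast h2
    have h3' : (fstar.pdf y : ℝ) ≠ 0 := by exact_mod_cast h3
    rw [Real.log_div h3' h2', Real.log_div h3' h1', Real.log_div h1' h2']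
    ring
  have hfin : klDiv fstar.law f.law ≠ ∞ :=
    klDiv_law_ne_top_iff.2 ⟨hf, (integrable_congr hadd).2 (hint₀.add hint)⟩
  rw [klContrast, ← EReal.coe_toReal (x := (klDiv fstar.law f.law : EReal)) (by simpa) (by simp),
    ← EReal.coe_toReal (x := (klDiv fstar.law f₀.law : EReal)) (by simpa) (by simp),
    EReal.toReal_coe_ennreal, EReal.toReal_coe_ennreal, toReal_klDiv_law hf, toReal_klDiv_law h₀,
    integral_congr_ae hadd, integral_add hint₀ hint, ← EReal.coe_sub]
  congr 1
  ring

lemma integrable_log_div_of_le {fstar f₀ f : Density μ} (hf₀ : klDiv fstar.law f₀.law ≠ ∞)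
    (hf : ∀ᵐ y ∂fstar.law, f.pdf y ≠ 0) {c : ℝ}
    (hc : ∀ᵐ y ∂fstar.law, Real.log (f₀.pdf y / f.pdf y) ≤ c) :
    Integrable (fun y => Real.log (f₀.pdf y / f.pdf y)) fstar.law := by
  obtain ⟨h₀, hint₀⟩ := klDiv_law_ne_top_iff.1 hf₀
  have hratio : Integrable (fun y => (f.pdf y : ℝ) / fstar.pdf y) fstar.law := by
    refine ⟨Measurable.aestronglyMeasurable (by fun_prop), ?_⟩
    calc ∫⁻ y, ‖(f.pdf y : ℝ) / fstar.pdf y‖ₑ ∂fstar.law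
        = ∫⁻ y, ((f.pdf y / fstar.pdf y : ℝ≥0) : ℝ≥0∞) ∂fstar.law := by
          refine lintegral_congr fun y => ?_
          rw [← NNReal.coe_div, Real.enorm_of_nonneg (NNReal.coe_nonneg _),
            ENNReal.ofReal_coe_nnreal]
      _ = ∫⁻ y, (fstar.pdf y : ℝ≥0∞) * ((f.pdf y / fstar.pdf y : ℝ≥0) : ℝ≥0∞) ∂μ :=
          fstar.lintegral_law (by fun_prop)
      _ ≤ ∫⁻ y, (f.pdf y : ℝ≥0∞) ∂μ := by
          refine lintegral_mono fun y => ?_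
          rw [← ENNReal.coe_mul, ENNReal.coe_le_coe]
          rcases eq_or_ne (fstar.pdf y) 0 with h | h
          · simp [h]
          · exact (mul_div_cancel₀ _ h).le
      _ < ∞ := by simp [f.lintegral_pdf]
  refine Integrable.mono' (((integrable_const |c|).add hratio).add hint₀.abs)
    (Measurable.aestronglyMeasurable (by fun_prop)) ?_
  filter_upwards [h₀, hf, fstar.pdf_ne_zero_ae_law, hc] with y h1 h2 h3 h4
  have h1' : (f₀.pdf y : ℝ) ≠ 0 := by exact_mod_cast h1
  have h2' : (f.pdf y : ℝ) ≠ 0 := by exact_mod_cast h2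
  have h3' : (fstar.pdf y : ℝ) ≠ 0 := by exact_mod_cast h3
  have h5 : Real.log (f.pdf y / fstar.pdf y) ≤ f.pdf y / fstar.pdf y - 1 :=
    Real.log_le_sub_one_of_pos (by positivity)
  rw [Real.log_div h2' h3'] at h5
  simp only [Pi.add_apply]
  have h6 := le_abs_self (Real.log (fstar.pdf y / f₀.pdf y))
  have h7 : (0 : ℝ) ≤ f.pdf y / fstar.pdf y := by positivity
  have h8 := le_abs_self c
  have h9 := abs_nonneg c
  have h10 := abs_nonneg (Real.log (fstar.pdf y / f₀.pdf y))
  rw [Real.norm_eq_abs, abs_le]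
  constructor
  · have := Real.log_div h3' h1'
    have := Real.log_div h1' h2'
    linarith
  · linarith

/-- The two-point mixture `(1 - t) f₀ + t f`. -/
lemma exists_segment_mem {F : Set (Density μ)} [MeasurableSpace F]
    (hF : Measurable fun q : F × 𝕐 => q.1.1.pdf q.2) (hconv : IsMixtureConvex F)
    {f₀ f : Density μ} (h₀ : f₀ ∈ F) (hf : f ∈ F) {t : ℝ≥0} (ht : t ≤ 1) :
    ∃ g ∈ F, ∀ᵐ y ∂μ, g.pdf y = (1 - t) * f₀.pdf y + t * f.pdf y := by
  obtain ⟨g, hg, hgy⟩ := hconv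
    (((1 - t : ℝ≥0) : ℝ≥0∞) • Measure.dirac (⟨f₀, h₀⟩ : F) + (t : ℝ≥0∞) • Measure.dirac (⟨f, hf⟩ : F))
    ⟨by
      simp only [Measure.coe_add, Measure.coe_smul, Pi.add_apply, Pi.smul_apply, measure_univ,
        smul_eq_mul, mul_one]
      rw [← ENNReal.coe_add, tsub_add_cancel_of_le ht, ENNReal.coe_one]⟩
  refine ⟨g, hg, ?_⟩
  filter_upwards [hgy] with y hy
  have hm : Measurable fun f : F => (f.1.pdf y : ℝ≥0∞) := by
    have : Measurable fun f : F => f.1.pdf y := hF.comp measurable_prodMk_right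
    fun_prop
  rw [lintegral_add_measure, lintegral_smul_measure, lintegral_smul_measure,
    lintegral_dirac' _ hm, lintegral_dirac' _ hm] at hy
  simp only [smul_eq_mul] at hy
  exact_mod_cast hy

/-- The first-order condition at the minimiser: differentiating `K*(f₀, ·)` along the segment from
`f₀` to `f` shows that `∫ (f / f₀) f* dμ ≤ 1` for every `f` in a convex model. -/
lemma lintegral_div_le_one {F : Set (Density μ)} [MeasurableSpace F]
    (hF : Measurable fun q : F × 𝕐 => q.1.1.pdf q.2) (hconv : IsMixtureConvex F)
    {fstar f₀ f : Density μ} (hf₀ : IsKLMinimizer fstar F f₀) (hf : f ∈ F) :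
    ∫⁻ y, ((f.pdf y / f₀.pdf y : ℝ≥0) : ℝ≥0∞) ∂fstar.law ≤ 1 := by
  obtain ⟨h₀F, hfin, hmin⟩ := hf₀
  obtain ⟨h₀, -⟩ := klDiv_law_ne_top_iff.1 hfin
  -- `s` is the excess of the ratio over `1`; `log (1 + t s) ≥ t s / (1 + t s)` replaces the
  -- difference quotient of the logarithm by an expression with an evident limit.
  let s : 𝕐 → ℝ := fun y => f.pdf y / f₀.pdf y - 1
  have hs : Measurable s := by fun_prop
  have hs1 : ∀ y, -1 ≤ s y := fun y => by
    have : (0 : ℝ) ≤ f.pdf y / f₀.pdf y := by positivity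
    simp only [s]
    linarith
  have key : ∀ t : ℝ≥0, 0 < t → t ≤ 1 / 2 →
      ∫⁻ y, ENNReal.ofReal (s y / (1 + t * s y) + 2) ∂fstar.law ≤ 2 := by
    intro t ht ht2
    have ht1 : t ≤ 1 := ht2.trans (by norm_num)
    have htR : (0 : ℝ) < t := ht
    have ht2R : (t : ℝ) ≤ 1 / 2 := by exact_mod_cast ht2
    obtain ⟨g, hgF, hg⟩ := exists_segment_mem hF hconv h₀F hf ht1
    have hg' : ∀ᵐ y ∂fstar.law, (g.pdf y : ℝ) = f₀.pdf y * (1 + t * s y) := by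
      filter_upwards [(withDensity_absolutelyContinuous _ _ : fstar.law ≪ μ).ae_le hg, h₀]
        with y hy h1
      have h1' : (f₀.pdf y : ℝ) ≠ 0 := by exact_mod_cast h1
      rw [hy]
      push_cast [NNReal.coe_sub ht1]
      simp only [s]
      field_simp
      ring
    have hpos : ∀ y, 1 / 2 ≤ 1 + t * s y := fun y => by nlinarith [hs1 y]
    have hlog : ∀ᵐ y ∂fstar.law, Real.log (f₀.pdf y / g.pdf y) = - Real.log (1 + t * s y) := by
      filter_upwards [hg', h₀] with y hy h1
      have h1' : (f₀.pdf y : ℝ) ≠ 0 := by exact_mod_cast h1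
      rw [hy, ← Real.log_inv]
      congr 1
      have := hpos y
      field_simp
    have hg0 : ∀ᵐ y ∂fstar.law, g.pdf y ≠ 0 := by
      filter_upwards [hg', h₀] with y hy h1
      have h1' : (f₀.pdf y : ℝ) ≠ 0 := by exact_mod_cast h1
      have : (g.pdf y : ℝ) ≠ 0 := by
        rw [hy]
        exact mul_ne_zero h1' (by linarith [hpos y])
      exact_mod_cast this
    have hint := integrable_log_div_of_le hfin hg0 (c := - Real.log (1 / 2)) (by
      filter_upwards [hlog] with y hy
      rw [hy]
      exact neg_le_neg (Real.log_le_log (by norm_num) (hpos y)))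
    have hnn := hmin g hgF
    rw [klContrast_eq_integral hfin hg0 hint, EReal.coe_nonneg, integral_congr_ae hlog,
      integral_neg] at hnn
    have hint' : Integrable (fun y => Real.log (1 + t * s y)) fstar.law := by
      simpa using ((integrable_congr hlog).1 hint).neg
    have hbd : ∀ y, s y / (1 + t * s y) ≤ Real.log (1 + t * s y) / t := by
      intro y
      have h1 := hpos y
      have h2 := Real.one_sub_inv_le_log_of_pos (show 0 < 1 + t * s y by linarith)
      rw [le_div_iff₀ htR]
      refine le_trans (le_of_eq ?_) h2
      have h3 : 1 + t * s y ≠ 0 := by linarith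
      rw [div_mul_eq_mul_div, show s y * t = (1 + t * s y) - 1 by ring, sub_div, div_self h3,
        one_div]
    have hlow : ∀ y, 0 ≤ s y / (1 + t * s y) + 2 := by
      intro y
      have h1 := hpos y
      have : -2 ≤ s y / (1 + t * s y) := by
        rw [le_div_iff₀ (by linarith)]
        nlinarith [hs1 y]
      linarith
    calc _ ≤ ∫⁻ y, ENNReal.ofReal (Real.log (1 + t * s y) / t + 2) ∂fstar.law :=
          lintegral_mono fun y => ENNReal.ofReal_le_ofReal (by linarith [hbd y])
      _ = ENNReal.ofReal (∫ y, (Real.log (1 + t * s y) / t + 2) ∂fstar.law) := by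
          rw [ofReal_integral_eq_lintegral_ofReal]
          · exact (hint'.div_const _).add (integrable_const _)
          · exact Eventually.of_forall fun y => (hlow y).trans (by linarith [hbd y])
      _ ≤ ENNReal.ofReal 2 := by
          apply ENNReal.ofReal_le_ofReal
          rw [integral_add (hint'.div_const _) (integrable_const _), integral_div]
          have : (∫ y, Real.log (1 + t * s y) ∂fstar.law) / t ≤ 0 :=
            div_nonpos_of_nonpos_of_nonneg (by linarith) htR.le
          simp
          linarith
      _ = 2 := by simp
  let t : ℕ → ℝ≥0 := fun k => 1 / ((k : ℝ≥0) + 2)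
  have ht : Tendsto (fun k => (t k : ℝ)) atTop (𝓝 0) := by
    have := (tendsto_one_div_add_atTop_nhds_zero_nat (𝕜 := ℝ)).comp (tendsto_add_atTop_nat 1)
    refine this.congr fun k => ?_
    simp only [Function.comp_apply, t]
    push_cast
    ring
  have hlim : ∀ y, Tendsto (fun k => ENNReal.ofReal (s y / (1 + t k * s y) + 2)) atTop
      (𝓝 (ENNReal.ofReal (s y + 2))) := by
    intro y
    refine ENNReal.tendsto_ofReal (Tendsto.add_const _ ?_)
    have h1 : Tendsto (fun k => 1 + (t k : ℝ) * s y) atTop (𝓝 1) := by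
      simpa using (ht.mul_const (s y)).const_add 1
    have h2 := (tendsto_const_nhds (x := s y)).div h1 one_ne_zero
    rwa [div_one] at h2
  have hfatou : ∫⁻ y, ENNReal.ofReal (s y + 2) ∂fstar.law ≤ 2 := by
    calc _ = ∫⁻ y, liminf (fun k => ENNReal.ofReal (s y / (1 + t k * s y) + 2)) atTop
              ∂fstar.law := lintegral_congr fun y => (hlim y).liminf_eq.symm
      _ ≤ liminf (fun k => ∫⁻ y, ENNReal.ofReal (s y / (1 + t k * s y) + 2) ∂fstar.law) atTop :=
          lintegral_liminf_le fun k => by fun_prop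
      _ ≤ liminf (fun _ : ℕ => (2 : ℝ≥0∞)) atTop := by
          refine liminf_le_liminf (Eventually.of_forall fun k => key _ (by positivity) ?_)
          simp only [t]
          gcongr
          simp
      _ = 2 := by simp
  have heq : ∀ y, ENNReal.ofReal (s y + 2) = ((f.pdf y / f₀.pdf y : ℝ≥0) : ℝ≥0∞) + 1 := by
    intro y
    rw [show s y + 2 = ((f.pdf y / f₀.pdf y : ℝ≥0) : ℝ) + 1 by simp [s]; ring,
      ENNReal.ofReal_add (by positivity) (by norm_num), ENNReal.ofReal_coe_nnreal,
      ENNReal.ofReal_one]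
  simp only [heq] at hfatou
  rw [lintegral_add_right _ (by fun_prop)] at hfatou
  have h2 : (2 : ℝ≥0∞) = 1 + 1 := by norm_num
  simp only [lintegral_const, measure_univ, mul_one] at hfatou
  rw [h2] at hfatou
  exact (ENNReal.add_le_add_iff_right (by simp)).1 hfatou

end KullbackLeibler

section PriorNeighbourhood

variable {𝕐 : Type*} [MeasurableSpace 𝕐] {μ : Measure 𝕐}

lemma measurable_ereal_abs : Measurable EReal.abs :=
  EReal.measurable_of_measurable_real (by
    simp only [EReal.abs_def]
    fun_prop)

lemma logSqContrast_eq_lintegral_law (fstar f₀ f : Density μ) :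
    logSqContrast fstar f₀ f = ∫⁻ y, (ENNReal.log
      ((f₀.pdf y : ℝ≥0∞) / (f.pdf y : ℝ≥0∞))).abs ^ 2 ∂fstar.law := by
  rw [fstar.lintegral_law]
  · exact lintegral_congr fun y => mul_comm _ _
  · have : Measurable fun y => ENNReal.log ((f₀.pdf y : ℝ≥0∞) / (f.pdf y : ℝ≥0∞)) :=
      ENNReal.measurable_log.comp (by fun_prop)
    exact (measurable_ereal_abs.comp this).pow_const 2

/-- `V*(f₀, f)` is finite only if `f` is positive almost everywhere under the true law. -/
lemma pdf_ne_zero_of_logSqContrast {fstar f₀ f : Density μ}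
    (h₀ : ∀ᵐ y ∂fstar.law, f₀.pdf y ≠ 0) (hV : logSqContrast fstar f₀ f ≠ ∞) :
    ∀ᵐ y ∂fstar.law, f.pdf y ≠ 0 := by
  rw [logSqContrast_eq_lintegral_law] at hV
  have hm : Measurable fun y => ENNReal.log ((f₀.pdf y : ℝ≥0∞) / (f.pdf y : ℝ≥0∞)) :=
    ENNReal.measurable_log.comp (by fun_prop)
  filter_upwards [ae_lt_top ((measurable_ereal_abs.comp hm).pow_const 2) hV, h₀] with y hy h1 h2
  simp [h2, ENNReal.div_zero, h1] at hy

lemma logSqContrast_eq_lintegral_ofReal {fstar f₀ f : Density μ}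
    (h₀ : ∀ᵐ y ∂fstar.law, f₀.pdf y ≠ 0) (hf : ∀ᵐ y ∂fstar.law, f.pdf y ≠ 0) :
    logSqContrast fstar f₀ f =
      ∫⁻ y, ENNReal.ofReal (Real.log (f₀.pdf y / f.pdf y) ^ 2) ∂fstar.law := by
  rw [logSqContrast_eq_lintegral_law]
  refine lintegral_congr_ae ?_
  filter_upwards [h₀, hf] with y h1 h2
  rw [← ENNReal.coe_div h2, ENNReal.log_of_nnreal (div_ne_zero h1 h2), EReal.abs_def,
    ← ENNReal.ofReal_pow (abs_nonneg _), sq_abs, NNReal.coe_div]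

lemma memLp_log_div {fstar f₀ f : Density μ}
    (h₀ : ∀ᵐ y ∂fstar.law, f₀.pdf y ≠ 0) (hV : logSqContrast fstar f₀ f ≠ ∞) :
    MemLp (fun y => Real.log (f₀.pdf y / f.pdf y)) 2 fstar.law := by
  rw [memLp_two_iff_integrable_sq (Measurable.aestronglyMeasurable (by fun_prop))]
  refine ⟨Measurable.aestronglyMeasurable (by fun_prop), ?_⟩
  rw [logSqContrast_eq_lintegral_ofReal h₀ (pdf_ne_zero_of_logSqContrast h₀ hV)] at hV
  rw [hasFiniteIntegral_iff_ofReal (Eventually.of_forall fun y => sq_nonneg _)]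
  exact hV.lt_top

/-- On `{V* ≤ v}` the contrast `K*(f₀, f)` is the integral of `log (f₀ / f)`, which depends
measurably on `f`. -/
lemma measurableSet_klContrast_logSqContrast [SFinite μ] {F : Set (Density μ)} [MeasurableSpace F]
    (hF : Measurable fun q : F × 𝕐 => q.1.1.pdf q.2) {fstar f₀ : Density μ}
    (hf₀ : klDiv fstar.law f₀.law ≠ ∞) (e v : ℝ) :
    MeasurableSet {f : F | klContrast fstar f₀ f.1 ≤ (e : EReal) ∧
      logSqContrast fstar f₀ f.1 ≤ ENNReal.ofReal v} := by
  obtain ⟨h₀, -⟩ := klDiv_law_ne_top_iff.1 hf₀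
  have hV : Measurable fun f : F => logSqContrast fstar f₀ f.1 := by
    simp only [logSqContrast_eq_lintegral_law]
    refine Measurable.lintegral_prod_right' (f := fun q : F × 𝕐 => (ENNReal.log
      ((f₀.pdf q.2 : ℝ≥0∞) / (q.1.1.pdf q.2 : ℝ≥0∞))).abs ^ 2) ?_
    have : Measurable fun q : F × 𝕐 =>
        ENNReal.log ((f₀.pdf q.2 : ℝ≥0∞) / (q.1.1.pdf q.2 : ℝ≥0∞)) :=
      ENNReal.measurable_log.comp (by fun_prop)
    exact (measurable_ereal_abs.comp this).pow_const 2
  have hK : Measurable fun f : F => ∫ y, Real.log (f₀.pdf y / f.1.pdf y) ∂fstar.law := by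
    have : StronglyMeasurable fun q : F × 𝕐 => Real.log (f₀.pdf q.2 / q.1.1.pdf q.2) :=
      Measurable.stronglyMeasurable (by fun_prop)
    exact (StronglyMeasurable.integral_prod_right' this).measurable
  have hset : {f : F | klContrast fstar f₀ f.1 ≤ (e : EReal) ∧
      logSqContrast fstar f₀ f.1 ≤ ENNReal.ofReal v} =
      {f : F | ∫ y, Real.log (f₀.pdf y / f.1.pdf y) ∂fstar.law ≤ e} ∩
      {f : F | logSqContrast fstar f₀ f.1 ≤ ENNReal.ofReal v} := by
    ext f
    simp only [Set.mem_ofPred_eq, Set.mem_inter_iff]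
    refine and_congr_left fun h => ?_
    have hV' := ne_top_of_le_ne_top ENNReal.ofReal_ne_top h
    rw [klContrast_eq_integral hf₀ (pdf_ne_zero_of_logSqContrast h₀ hV')
      ((memLp_log_div h₀ hV').integrable (by norm_num)), EReal.coe_le_coe_iff]
  rw [hset]
  exact (measurableSet_le hK measurable_const).inter (measurableSet_le hV measurable_const)

end PriorNeighbourhood

/-! ### Square roots of integrated likelihoods -/

section RootLikelihood

variable {𝕐 : Type*} [MeasurableSpace 𝕐] {μ : Measure 𝕐}

/-- One observation: if the mixtures in the model of probability measures concentrated on `S` have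
weighted affinity at most `ρ` with `f₀`, then by homogeneity the same holds, up to the total mass,
for the mixture of any measure concentrated on `S`. -/
lemma lintegral_sqrt_mixture_le {F : Set (Density μ)} [MeasurableSpace F]
    (hF : Measurable fun q : F × 𝕐 => q.1.1.pdf q.2) (hconv : IsMixtureConvex F)
    {fstar f₀ : Density μ} {S : Set F} {ρ : ℝ≥0∞} (hρ0 : ρ ≠ 0)
    (hρ : ∀ (Φ : Measure F) [IsProbabilityMeasure Φ], (∀ᵐ f ∂Φ, f ∈ S) → ∀ h ∈ F,
      (∀ᵐ y ∂μ, (h.pdf y : ℝ≥0∞) = ∫⁻ f : F, (f.1.pdf y : ℝ≥0∞) ∂Φ) →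
      ∫⁻ y, ((h.pdf y / f₀.pdf y : ℝ≥0) : ℝ≥0∞) ^ (1 / 2 : ℝ) ∂fstar.law ≤ ρ)
    (Φ : Measure F) (hΦ : ∀ᵐ f ∂Φ, f ∈ S) :
    ∫⁻ y, (∫⁻ f : F, ((f.1.pdf y / f₀.pdf y : ℝ≥0) : ℝ≥0∞) ∂Φ) ^ (1 / 2 : ℝ) ∂fstar.law
      ≤ ρ * Φ Set.univ ^ (1 / 2 : ℝ) := by
  rcases eq_or_ne (Φ Set.univ) 0 with h0 | h0
  · simp [Measure.measure_univ_eq_zero.1 h0]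
  rcases eq_or_ne (Φ Set.univ) ∞ with htop | htop
  · simp [htop, hρ0]
  have hprob : IsProbabilityMeasure ((Φ Set.univ)⁻¹ • Φ) :=
    ⟨by simp [ENNReal.inv_mul_cancel h0 htop]⟩
  obtain ⟨h, hhF, hh⟩ := hconv ((Φ Set.univ)⁻¹ • Φ) hprob
  have hbd := hρ ((Φ Set.univ)⁻¹ • Φ) (Measure.ae_smul_measure hΦ _) h hhF hh
  have hh' : ∀ᵐ y ∂fstar.law, ∫⁻ f : F, ((f.1.pdf y / f₀.pdf y : ℝ≥0) : ℝ≥0∞) ∂Φ =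
      Φ Set.univ * ((h.pdf y / f₀.pdf y : ℝ≥0) : ℝ≥0∞) := by
    filter_upwards [(withDensity_absolutelyContinuous _ _ : fstar.law ≪ μ).ae_le hh] with y hy
    have hm : Measurable fun f : F => f.1.pdf y := hF.comp measurable_prodMk_right
    simp only [div_eq_mul_inv, ENNReal.coe_mul]
    rw [lintegral_mul_const _ (by fun_prop), hy, lintegral_smul_measure, smul_eq_mul, ← mul_assoc,
      ← mul_assoc, ENNReal.mul_inv_cancel h0 htop, one_mul]
  calc _ = ∫⁻ y, Φ Set.univ ^ (1 / 2 : ℝ) *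
        ((h.pdf y / f₀.pdf y : ℝ≥0) : ℝ≥0∞) ^ (1 / 2 : ℝ) ∂fstar.law := by
        refine lintegral_congr_ae ?_
        filter_upwards [hh'] with y hy
        rw [hy, ENNReal.mul_rpow_of_nonneg _ _ (by norm_num)]
    _ ≤ ρ * Φ Set.univ ^ (1 / 2 : ℝ) := by
        rw [lintegral_const_mul _ (by fun_prop), mul_comm]
        gcongr

variable {Ω : Type*} [MeasurableSpace Ω] {P : Measure Ω} [IsProbabilityMeasure P]

/-- The new observation `Y n` can be integrated out separately from the first `n`. -/
lemma lintegral_eq_lintegral_prod {Y : ℕ → Ω → 𝕐} (hY : ∀ i, Measurable (Y i))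
    (hindep : iIndepFun Y P) {ν : Measure 𝕐} (hlaw : ∀ i, P.map (Y i) = ν) (n : ℕ)
    {G : (Finset.range n → 𝕐) × 𝕐 → ℝ≥0∞} (hG : Measurable G) :
    ∫⁻ ω, G (fun i => Y i ω, Y n ω) ∂P = ∫⁻ ω, ∫⁻ z, G (fun i => Y i ω, z) ∂ν ∂P := by
  have hX : Measurable fun ω => fun i : Finset.range n => Y i ω :=
    measurable_pi_lambda _ fun i => hY i
  have hind : IndepFun (fun ω => fun i : Finset.range n => Y i ω) (Y n) P := by
    have h := hindep.indepFun_finset (Finset.range n) {n} (by simp) hY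
    exact h.comp measurable_id
      (measurable_pi_apply (⟨n, Finset.mem_singleton_self n⟩ : ({n} : Finset ℕ)))
  have hν : IsProbabilityMeasure ν := by
    rw [← hlaw 0]
    exact Measure.isProbabilityMeasure_map (hY 0).aemeasurable
  have hmap := hind.map_prod_eq_prod_map_map hX.aemeasurable (hY n).aemeasurable
  rw [← lintegral_map (f := G) hG (hX.prodMk (hY n)), hmap, hlaw, lintegral_prod _ hG.aemeasurable,
    lintegral_map hG.lintegral_prod_right' hX]

lemma measurable_likelihoodRatio {F : Set (Density μ)} [MeasurableSpace F]
    (hF : Measurable fun q : F × 𝕐 => q.1.1.pdf q.2) (f₀ : Density μ)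
    {Y : ℕ → Ω → 𝕐} (hY : ∀ i, Measurable (Y i)) (n : ℕ) :
    Measurable fun q : F × Ω => likelihoodRatio f₀ q.1.1 n (fun i => Y i q.2) := by
  unfold likelihoodRatio
  refine Finset.measurable_prod _ fun i _ => Measurable.div ?_ ?_
  · exact hF.comp (measurable_fst.prodMk ((hY i).comp measurable_snd))
  · exact f₀.measurable_pdf.comp ((hY i).comp measurable_snd)

lemma measurable_lintegral_likelihoodRatio {F : Set (Density μ)} [MeasurableSpace F]
    (hF : Measurable fun q : F × 𝕐 => q.1.1.pdf q.2) (f₀ : Density μ)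
    {Y : ℕ → Ω → 𝕐} (hY : ∀ i, Measurable (Y i)) (n : ℕ) (Φ : Measure F) [SFinite Φ] :
    Measurable fun ω => ∫⁻ f : F, (likelihoodRatio f₀ f.1 n (fun i => Y i ω) : ℝ≥0∞) ∂Φ :=
  Measurable.lintegral_prod_left' (μ := Φ)
    (f := fun q : F × Ω => (likelihoodRatio f₀ q.1.1 n (fun i => Y i q.2) : ℝ≥0∞))
    (measurable_likelihoodRatio hF f₀ hY n).coe_nnreal_ennreal

/-- The square root of the integrated likelihood contracts by the factor `ρ` with each
observation. The integrated likelihood after `n + 1` observations is the mixture, evaluated at the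
last observation, for the measure obtained from `Φ` by reweighting with `R_n`, so the one-observation
bound applies conditionally on the first `n` observations. -/
lemma lintegral_sqrt_lintegral_likelihoodRatio_le {F : Set (Density μ)} [MeasurableSpace F]
    (hF : Measurable fun q : F × 𝕐 => q.1.1.pdf q.2) (hconv : IsMixtureConvex F)
    {fstar f₀ : Density μ} {S : Set F} {ρ : ℝ≥0∞} (hρ0 : ρ ≠ 0)
    (hρ : ∀ (Φ : Measure F) [IsProbabilityMeasure Φ], (∀ᵐ f ∂Φ, f ∈ S) → ∀ h ∈ F,
      (∀ᵐ y ∂μ, (h.pdf y : ℝ≥0∞) = ∫⁻ f : F, (f.1.pdf y : ℝ≥0∞) ∂Φ) →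
      ∫⁻ y, ((h.pdf y / f₀.pdf y : ℝ≥0) : ℝ≥0∞) ^ (1 / 2 : ℝ) ∂fstar.law ≤ ρ)
    (Φ : Measure F) [SFinite Φ] (hΦ : ∀ᵐ f ∂Φ, f ∈ S)
    {Y : ℕ → Ω → 𝕐} (hY : ∀ i, Measurable (Y i))
    (hindep : iIndepFun Y P) (hlaw : ∀ i, P.map (Y i) = fstar.law) (n : ℕ) :
    ∫⁻ ω, (∫⁻ f : F, (likelihoodRatio f₀ f.1 n (fun i => Y i ω) : ℝ≥0∞) ∂Φ) ^ (1 / 2 : ℝ) ∂P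
      ≤ ρ ^ n * Φ Set.univ ^ (1 / 2 : ℝ) := by
  induction n with
  | zero => simp [likelihoodRatio]
  | succ n ih =>
    let q : F → (Finset.range n → 𝕐) → ℝ≥0 := fun f x => ∏ i, f.1.pdf (x i) / f₀.pdf (x i)
    have hq : ∀ (f : F) (ω : Ω), q f (fun i => Y i ω)
        = likelihoodRatio f₀ f.1 n (fun i => Y i ω) := by
      intro f ω
      exact Finset.prod_coe_sort (Finset.range n) (fun i => f.1.pdf (Y i ω) / f₀.pdf (Y i ω))
    have hqm : Measurable fun p : F × (Finset.range n → 𝕐) => q p.1 p.2 := by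
      refine Finset.measurable_prod _ fun i _ => Measurable.div ?_ ?_
      · exact hF.comp (measurable_fst.prodMk ((measurable_pi_apply i).comp measurable_snd))
      · exact f₀.measurable_pdf.comp ((measurable_pi_apply i).comp measurable_snd)
    let G : (Finset.range n → 𝕐) × 𝕐 → ℝ≥0∞ := fun p =>
      (∫⁻ f : F, ((q f p.1 * (f.1.pdf p.2 / f₀.pdf p.2) : ℝ≥0) : ℝ≥0∞) ∂Φ) ^ (1 / 2 : ℝ)
    have hG : Measurable G := by
      refine Measurable.pow_const ?_ _
      refine Measurable.lintegral_prod_left' (μ := Φ)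
        (f := fun t : F × ((Finset.range n → 𝕐) × 𝕐) =>
          ((q t.1 t.2.1 * (t.1.1.pdf t.2.2 / f₀.pdf t.2.2) : ℝ≥0) : ℝ≥0∞)) ?_
      refine Measurable.coe_nnreal_ennreal (Measurable.mul ?_ (Measurable.div ?_ ?_))
      · exact hqm.comp (measurable_fst.prodMk (measurable_fst.comp measurable_snd))
      · exact hF.comp (measurable_fst.prodMk (measurable_snd.comp measurable_snd))
      · exact f₀.measurable_pdf.comp (measurable_snd.comp measurable_snd)
    calc _ = ∫⁻ ω, G (fun i => Y i ω, Y n ω) ∂P := by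
          refine lintegral_congr fun ω => ?_
          simp only [G, hq, likelihoodRatio, Finset.prod_range_succ]
      _ = ∫⁻ ω, ∫⁻ z, G (fun i => Y i ω, z) ∂fstar.law ∂P :=
          lintegral_eq_lintegral_prod hY hindep hlaw n hG
      _ ≤ ∫⁻ ω, ρ * (∫⁻ f : F, (likelihoodRatio f₀ f.1 n (fun i => Y i ω) : ℝ≥0∞) ∂Φ)
            ^ (1 / 2 : ℝ) ∂P := by
          refine lintegral_mono fun ω => ?_
          have hqx : Measurable fun f : F => (q f (fun i => Y i ω) : ℝ≥0∞) :=
            (hqm.comp measurable_prodMk_right).coe_nnreal_ennreal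
          have h := lintegral_sqrt_mixture_le hF hconv (fstar := fstar) (f₀ := f₀) hρ0 hρ
            (Φ.withDensity fun f => (q f (fun i => Y i ω) : ℝ≥0∞))
            ((withDensity_absolutelyContinuous _ _).ae_le hΦ)
          simp only [← hq]
          rw [withDensity_apply _ MeasurableSet.univ, Measure.restrict_univ] at h
          refine le_trans (le_of_eq ?_) h
          refine lintegral_congr fun z => ?_
          have hz : Measurable fun f : F => ((f.1.pdf z / f₀.pdf z : ℝ≥0) : ℝ≥0∞) := by
            have : Measurable fun f : F => f.1.pdf z := hF.comp measurable_prodMk_right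
            fun_prop
          simp only [G]
          rw [lintegral_withDensity_eq_lintegral_mul _ hqx hz]
          simp
      _ = ρ * ∫⁻ ω, (∫⁻ f : F, (likelihoodRatio f₀ f.1 n (fun i => Y i ω) : ℝ≥0∞) ∂Φ)
            ^ (1 / 2 : ℝ) ∂P :=
          lintegral_const_mul _
            ((measurable_lintegral_likelihoodRatio hF f₀ hY n Φ).pow_const _)
      _ ≤ ρ * (ρ ^ n * Φ Set.univ ^ (1 / 2 : ℝ)) := by gcongr
      _ = ρ ^ (n + 1) * Φ Set.univ ^ (1 / 2 : ℝ) := by ring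

/-- No separation from `f₀` is needed for the factor `1`. -/
lemma lintegral_sqrt_div_le_one {F : Set (Density μ)} [MeasurableSpace F]
    (hF : Measurable fun q : F × 𝕐 => q.1.1.pdf q.2) (hconv : IsMixtureConvex F)
    {fstar f₀ h : Density μ} (hf₀ : IsKLMinimizer fstar F f₀) (hh : h ∈ F) :
    ∫⁻ y, ((h.pdf y / f₀.pdf y : ℝ≥0) : ℝ≥0∞) ^ (1 / 2 : ℝ) ∂fstar.law ≤ 1 := by
  have h1 := affinity_add_hellingerStar_sq_le fstar f₀ h (lintegral_div_le_one hF hconv hf₀ hh)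
  have h2 := le_trans le_self_add h1
  rw [← ENNReal.mul_le_mul_iff_right two_ne_zero ENNReal.ofNat_ne_top]
  simpa using h2

/-- A density of the model at `H*`-distance at least `d` from `f₀` has weighted affinity at most
`1 - d² / 2 ≤ exp (-d² / 2)` with it. -/
lemma lintegral_sqrt_div_le_exp {F : Set (Density μ)} [MeasurableSpace F]
    (hF : Measurable fun q : F × 𝕐 => q.1.1.pdf q.2) (hconv : IsMixtureConvex F)
    {fstar f₀ h : Density μ} (hf₀ : IsKLMinimizer fstar F f₀) (hh : h ∈ F) {d : ℝ} (hd : 0 ≤ d)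
    (hdist : ENNReal.ofReal d ≤ hellingerStar fstar f₀ f₀ h) :
    ∫⁻ y, ((h.pdf y / f₀.pdf y : ℝ≥0) : ℝ≥0∞) ^ (1 / 2 : ℝ) ∂fstar.law
      ≤ ENNReal.ofReal (Real.exp (-(d ^ 2 / 2))) := by
  have h1 := affinity_add_hellingerStar_sq_le fstar f₀ h (lintegral_div_le_one hF hconv hf₀ hh)
  have hle := lintegral_sqrt_div_le_one hF hconv hf₀ hh
  set a := ∫⁻ y, ((h.pdf y / f₀.pdf y : ℝ≥0) : ℝ≥0∞) ^ (1 / 2 : ℝ) ∂fstar.law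
  have ha : a ≠ ∞ := ne_top_of_le_ne_top ENNReal.one_ne_top hle
  have h2 : 2 * a + ENNReal.ofReal d ^ 2 ≤ 2 := le_trans (by gcongr) h1
  rw [← ENNReal.ofReal_toReal ha, ← ENNReal.ofReal_pow hd,
    show (2 : ℝ≥0∞) = ENNReal.ofReal 2 by simp, ← ENNReal.ofReal_mul (by norm_num),
    ← ENNReal.ofReal_add (by positivity) (by positivity),
    ENNReal.ofReal_le_ofReal_iff (by norm_num)] at h2
  rw [← ENNReal.ofReal_toReal ha]
  apply ENNReal.ofReal_le_ofReal
  have := Real.add_one_le_exp (-(d ^ 2 / 2))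
  linarith

/-- The part of a ball of radius `δ` lying at distance at least `d + 2 δ` from `f₀`: its mixtures
stay in the ball, hence at distance at least `d` from `f₀`. -/
lemma lintegral_sqrt_likelihoodRatio_ball_le [SFinite μ] {F : Set (Density μ)} [MeasurableSpace F]
    (hF : Measurable fun q : F × 𝕐 => q.1.1.pdf q.2) (hconv : IsMixtureConvex F)
    {fstar f₀ : Density μ} (hf₀ : IsKLMinimizer fstar F f₀) (g : Density μ) {d δ : ℝ} (hd : 0 ≤ d)
    (hδ : 0 ≤ δ) (prior : Measure F) [IsProbabilityMeasure prior]
    {Y : ℕ → Ω → 𝕐} (hY : ∀ i, Measurable (Y i))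
    (hindep : iIndepFun Y P) (hlaw : ∀ i, P.map (Y i) = fstar.law) (n : ℕ) :
    ∫⁻ ω, (∫⁻ f : F in {f : F | hellingerStar fstar f₀ f.1 g ≤ ENNReal.ofReal δ ∧
        ENNReal.ofReal (d + 2 * δ) ≤ hellingerStar fstar f₀ f₀ f.1},
        (likelihoodRatio f₀ f.1 n (fun i => Y i ω) : ℝ≥0∞) ∂prior) ^ (1 / 2 : ℝ) ∂P
      ≤ ENNReal.ofReal (Real.exp (-(d ^ 2 / 2))) ^ n := by
  set S : Set F := {f : F | hellingerStar fstar f₀ f.1 g ≤ ENNReal.ofReal δ ∧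
        ENNReal.ofReal (d + 2 * δ) ≤ hellingerStar fstar f₀ f₀ f.1}
  have hS : MeasurableSet S := by
    have h1 := measurable_hellingerStar hF fstar f₀ g
    have h2 := measurable_hellingerStar hF fstar f₀ f₀
    simp only [hellingerStar_comm fstar f₀ _ f₀] at h2
    exact (measurableSet_le h1 measurable_const).inter (measurableSet_le measurable_const h2)
  refine (lintegral_sqrt_lintegral_likelihoodRatio_le hF hconv (S := S)
    (ρ := ENNReal.ofReal (Real.exp (-(d ^ 2 / 2)))) (by simp [Real.exp_pos]) ?_
    (prior.restrict S) (ae_restrict_mem hS) hY hindep hlaw n).trans ?_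
  · intro Φ _ hΦ h hh hmix
    refine lintegral_sqrt_div_le_exp hF hconv hf₀ hh hd ?_
    have hball := hellingerStar_mixture_le hF fstar f₀ g Φ (hΦ.mono fun f hf => hf.1) hmix
    obtain ⟨f, hfg, hf⟩ := hΦ.exists
    have htri := (hellingerStar_triangle fstar f₀ f₀ h f.1).trans
      (add_le_add_right (hellingerStar_triangle fstar f₀ h g f.1) _)
    rw [hellingerStar_comm fstar f₀ g f.1] at htri
    have h2 : ENNReal.ofReal d + 2 * ENNReal.ofReal δ
        ≤ hellingerStar fstar f₀ f₀ h + 2 * ENNReal.ofReal δ := by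
      rw [ENNReal.ofReal_add hd (by positivity), ENNReal.ofReal_mul (by norm_num)] at hf
      calc _ ≤ _ := by simpa using hf
        _ ≤ _ := htri
        _ ≤ hellingerStar fstar f₀ f₀ h + (ENNReal.ofReal δ + ENNReal.ofReal δ) := by gcongr
        _ = _ := by rw [two_mul]
    exact (ENNReal.add_le_add_iff_right (by finiteness)).1 h2
  · refine mul_le_of_le_one_right' ?_
    exact ENNReal.rpow_le_one (by simpa using prob_le_one) (by norm_num)

end RootLikelihood

/-! ### Lower bound on the evidence -/

section Evidence

variable {𝕐 : Type*} [MeasurableSpace 𝕐] {μ : Measure 𝕐}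
  {Ω : Type*} [MeasurableSpace Ω] {P : Measure Ω} [IsProbabilityMeasure P]

/-- Chebyshev's inequality for the log-likelihood ratio of a fixed density in the Kullback--Leibler
neighbourhood: it has mean at most `n e` and variance at most `n e`. -/
lemma measure_sum_log_div_ge_le {fstar f₀ f : Density μ} (hfin : klDiv fstar.law f₀.law ≠ ∞)
    {e : ℝ} (he : 0 < e) (hK : klContrast fstar f₀ f ≤ (e : EReal))
    (hV : logSqContrast fstar f₀ f ≤ ENNReal.ofReal e)
    {Y : ℕ → Ω → 𝕐} (hY : ∀ i, Measurable (Y i))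
    (hindep : iIndepFun Y P) (hlaw : ∀ i, P.map (Y i) = fstar.law)
    {c : ℝ} (hc : 0 < c) {n : ℕ} (hn : 0 < n) :
    P {ω | (1 + c) * (n * e) ≤ ∑ i ∈ Finset.range n, Real.log (f₀.pdf (Y i ω) / f.pdf (Y i ω))}
      ≤ ENNReal.ofReal (1 / (c ^ 2 * (n * e))) := by
  obtain ⟨h₀, -⟩ := klDiv_law_ne_top_iff.1 hfin
  have hV' := ne_top_of_le_ne_top ENNReal.ofReal_ne_top hV
  have hf := pdf_ne_zero_of_logSqContrast h₀ hV'
  set L : 𝕐 → ℝ := fun y => Real.log (f₀.pdf y / f.pdf y) with hLdef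
  have hLm : Measurable L := by fun_prop
  have hL2 : MemLp L 2 fstar.law := memLp_log_div h₀ hV'
  have hmean : ∫ y, L y ∂fstar.law ≤ e := by
    rwa [klContrast_eq_integral hfin hf (hL2.integrable (by norm_num)), EReal.coe_le_coe_iff] at hK
  have hsq : ∫ y, L y ^ 2 ∂fstar.law ≤ e := by
    rw [integral_eq_lintegral_of_nonneg_ae (Eventually.of_forall fun y => sq_nonneg _)
      (Measurable.aestronglyMeasurable (by fun_prop)),
      ← logSqContrast_eq_lintegral_ofReal h₀ hf]
    exact ENNReal.toReal_le_of_le_ofReal he.le hV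
  let X : ℕ → Ω → ℝ := fun i ω => L (Y i ω)
  have hmp : ∀ i, MeasurePreserving (Y i) P fstar.law := fun i => ⟨hY i, hlaw i⟩
  have hX2 : ∀ i, MemLp (X i) 2 P := fun i => hL2.comp_measurePreserving (hmp i)
  have hXint : ∀ i, ∫ ω, X i ω ∂P = ∫ y, L y ∂fstar.law := fun i => by
    rw [← hlaw i, integral_map (hY i).aemeasurable hLm.aestronglyMeasurable]
  have hXvar : ∀ i, variance (X i) P ≤ e := fun i => by
    refine (variance_le_expectation_sq (hX2 i).1).trans ?_
    refine le_trans (le_of_eq ?_) hsq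
    rw [← hlaw i, integral_map (hY i).aemeasurable (hLm.pow_const 2).aestronglyMeasurable]
    rfl
  have hsum2 : MemLp (∑ i ∈ Finset.range n, X i) 2 P := memLp_finsetSum' _ fun i _ => hX2 i
  have hvar : variance (∑ i ∈ Finset.range n, X i) P ≤ n * e := by
    rw [IndepFun.variance_sum (fun i _ => hX2 i) fun i _ j _ hij =>
      (hindep.indepFun hij).comp hLm hLm]
    simpa using Finset.sum_le_card_nsmul (Finset.range n) _ e fun i _ => hXvar i
  have hne : 0 < (n : ℝ) * e := by positivity
  have hexp : P[∑ i ∈ Finset.range n, X i] ≤ n * e := by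
    simp only [Finset.sum_apply]
    rw [integral_finsetSum _ fun i _ => (hX2 i).integrable (by norm_num)]
    simp only [hXint, Finset.sum_const, Finset.card_range, nsmul_eq_mul]
    gcongr
  have hcheb := meas_ge_le_variance_div_sq hsum2 (c := c * (n * e)) (by positivity)
  refine le_trans (measure_mono fun ω hω => ?_) (hcheb.trans (ENNReal.ofReal_le_ofReal ?_))
  · simp only [Set.mem_ofPred_eq] at hω ⊢
    refine le_trans ?_ (le_abs_self _)
    have : (∑ i ∈ Finset.range n, X i) ω = ∑ i ∈ Finset.range n,
        Real.log (f₀.pdf (Y i ω) / f.pdf (Y i ω)) := by simp [X, L]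
    rw [this]
    linarith
  · rw [div_le_div_iff₀ (by positivity) (by positivity)]
    calc _ ≤ (n * e) * (c ^ 2 * (n * e)) := by gcongr
      _ = _ := by ring

/-- A fixed density in the Kullback--Leibler neighbourhood has likelihood ratio at least
`exp (-(1 + c) n e)` with high probability. -/
lemma measure_likelihoodRatio_lt_le {fstar f₀ f : Density μ} (hfin : klDiv fstar.law f₀.law ≠ ∞)
    {e : ℝ} (he : 0 < e) (hK : klContrast fstar f₀ f ≤ (e : EReal))
    (hV : logSqContrast fstar f₀ f ≤ ENNReal.ofReal e)
    {Y : ℕ → Ω → 𝕐} (hY : ∀ i, Measurable (Y i))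
    (hindep : iIndepFun Y P) (hlaw : ∀ i, P.map (Y i) = fstar.law)
    {c : ℝ} (hc : 0 < c) {n : ℕ} (hn : 0 < n) :
    P {ω | (likelihoodRatio f₀ f n (fun i => Y i ω) : ℝ≥0∞)
        < ENNReal.ofReal (Real.exp (-((1 + c) * (n * e))))}
      ≤ ENNReal.ofReal (1 / (c ^ 2 * (n * e))) := by
  obtain ⟨h₀, -⟩ := klDiv_law_ne_top_iff.1 hfin
  have hf := pdf_ne_zero_of_logSqContrast h₀ (ne_top_of_le_ne_top ENNReal.ofReal_ne_top hV)
  have hpos : ∀ᵐ ω ∂P, ∀ i, f₀.pdf (Y i ω) ≠ 0 ∧ f.pdf (Y i ω) ≠ 0 := by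
    rw [ae_all_iff]
    intro i
    have := h₀.and hf
    rw [← hlaw i] at this
    exact ae_of_ae_map (hY i).aemeasurable this
  refine le_trans (measure_mono_ae ?_)
    (measure_sum_log_div_ge_le hfin he hK hV hY hindep hlaw hc hn)
  filter_upwards [hpos] with ω hω hlt
  change (1 + c) * (n * e) ≤ _
  change _ < _ at hlt
  by_contra! hcon
  refine absurd hlt (not_lt.2 ?_)
  have hR : ((likelihoodRatio f₀ f n (fun i => Y i ω) : ℝ≥0) : ℝ) = Real.exp
      (-∑ i ∈ Finset.range n, Real.log (f₀.pdf (Y i ω) / f.pdf (Y i ω))) := by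
    rw [likelihoodRatio, ← Finset.sum_neg_distrib, Real.exp_sum]
    push_cast
    refine Finset.prod_congr rfl fun i _ => ?_
    obtain ⟨h1, h2⟩ := hω i
    have h1' : (0 : ℝ) < f₀.pdf (Y i ω) := by positivity
    have h2' : (0 : ℝ) < f.pdf (Y i ω) := by positivity
    rw [← Real.log_inv, inv_div, Real.exp_log (by positivity)]
  rw [← ENNReal.ofReal_coe_nnreal, hR]
  apply ENNReal.ofReal_le_ofReal
  exact Real.exp_le_exp.2 (by linarith)

/-- Lower bound on the evidence. By Tonelli, on average over the data only a small part of the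
neighbourhood `B` carries a small likelihood ratio; by Markov's inequality at least half of the
prior mass of `B` does not, except with small probability. -/
lemma measure_evidence_lt_le [SFinite μ] {F : Set (Density μ)} [MeasurableSpace F]
    (hF : Measurable fun q : F × 𝕐 => q.1.1.pdf q.2) {fstar f₀ : Density μ}
    (hfin : klDiv fstar.law f₀.law ≠ ∞) (prior : Measure F) [IsProbabilityMeasure prior]
    {e : ℝ} (he : 0 < e) {β : ℝ≥0∞} (hβ0 : β ≠ 0)
    (hβ : β ≤ prior {f : F | klContrast fstar f₀ f.1 ≤ (e : EReal) ∧
        logSqContrast fstar f₀ f.1 ≤ ENNReal.ofReal e})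
    {Y : ℕ → Ω → 𝕐} (hY : ∀ i, Measurable (Y i))
    (hindep : iIndepFun Y P) (hlaw : ∀ i, P.map (Y i) = fstar.law)
    {c : ℝ} (hc : 0 < c) {n : ℕ} (hn : 0 < n) :
    P {ω | ∫⁻ f : F, (likelihoodRatio f₀ f.1 n (fun i => Y i ω) : ℝ≥0∞) ∂prior
        < ENNReal.ofReal (Real.exp (-((1 + c) * (n * e)))) * (β / 2)}
      ≤ 2 * ENNReal.ofReal (1 / (c ^ 2 * (n * e))) := by
  set B : Set F := {f : F | klContrast fstar f₀ f.1 ≤ (e : EReal) ∧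
        logSqContrast fstar f₀ f.1 ≤ ENNReal.ofReal e}
  have hB : MeasurableSet B := measurableSet_klContrast_logSqContrast hF hfin e e
  set ℓ : ℝ≥0∞ := ENNReal.ofReal (Real.exp (-((1 + c) * (n * e))))
  set η : ℝ≥0∞ := ENNReal.ofReal (1 / (c ^ 2 * (n * e)))
  have hR := (measurable_likelihoodRatio hF f₀ hY n).coe_nnreal_ennreal
  let bad : Set (F × Ω) :=
    {q | (likelihoodRatio f₀ q.1.1 n (fun i => Y i q.2) : ℝ≥0∞) < ℓ}
  have hbad : MeasurableSet bad := measurableSet_lt hR measurable_const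
  have hpB : prior B ≠ 0 := fun h => hβ0 (le_zero_iff.1 (h ▸ hβ))
  have hpB' : prior B ≠ ∞ := measure_ne_top _ _
  -- the expected prior mass of the bad part of `B`
  have hE : ∫⁻ ω, prior.restrict B {f | (f, ω) ∈ bad} ∂P ≤ η * prior B := by
    calc _ = ((prior.restrict B).prod P) bad := (Measure.prod_apply_symm hbad).symm
      _ = ∫⁻ f in B, P {ω | (f, ω) ∈ bad} ∂prior := Measure.prod_apply hbad
      _ ≤ ∫⁻ _ in B, η ∂prior := by
          refine setLIntegral_mono measurable_const fun f hf => ?_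
          exact measure_likelihoodRatio_lt_le hfin he hf.1 hf.2 hY hindep hlaw hc hn
      _ = η * prior B := by simp
  have hsub : {ω | ∫⁻ f : F, (likelihoodRatio f₀ f.1 n (fun i => Y i ω) : ℝ≥0∞) ∂prior
        < ℓ * (β / 2)} ⊆ {ω | prior B / 2 ≤ prior.restrict B {f | (f, ω) ∈ bad}} := by
    intro ω hω
    by_contra! hcon
    rw [Set.mem_ofPred_eq] at hω
    refine absurd hω (not_lt.2 ?_)
    have hcon' : prior.restrict B {f | (f, ω) ∈ bad} ≤ prior B / 2 := (not_le.1 hcon).le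
    have hgood : prior B / 2 ≤ prior.restrict B {f | (f, ω) ∈ bad}ᶜ := by
      have hs : MeasurableSet {f | (f, ω) ∈ bad} := measurable_prodMk_right hbad
      rw [measure_compl hs (measure_ne_top _ _), Measure.restrict_apply_univ]
      refine ENNReal.le_sub_of_add_le_right (measure_ne_top _ _) ?_
      calc _ ≤ prior B / 2 + prior B / 2 := by gcongr
        _ = prior B := ENNReal.add_halves _
    calc ℓ * (β / 2) ≤ ℓ * prior.restrict B {f | (f, ω) ∈ bad}ᶜ := by
          gcongr
          exact le_trans (by gcongr) hgood
      _ ≤ ℓ * prior.restrict B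
            {f : F | ℓ ≤ (likelihoodRatio f₀ f.1 n (fun i => Y i ω) : ℝ≥0∞)} := by
          gcongr
          intro f hf
          rw [Set.mem_compl_iff, Set.mem_ofPred_eq, Set.mem_ofPred_eq] at hf
          exact not_lt.1 hf
      _ ≤ ∫⁻ f in B, (likelihoodRatio f₀ f.1 n (fun i => Y i ω) : ℝ≥0∞) ∂prior :=
          mul_meas_ge_le_lintegral (hR.comp measurable_prodMk_right) _
      _ ≤ _ := setLIntegral_le_lintegral _ _
  refine (measure_mono hsub).trans ?_
  refine (meas_ge_le_lintegral_div (measurable_measure_prodMk_right hbad).aemeasurable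
    (by simpa using hpB) (by finiteness)).trans ?_
  calc _ ≤ η * prior B / (prior B / 2) := by
        gcongr
        exact hE
    _ = 2 * η := by
      rw [ENNReal.div_eq_inv_mul, ENNReal.inv_div (by simp) (by simp), ENNReal.div_eq_inv_mul,
        mul_comm η, ← mul_assoc, mul_comm (prior B)⁻¹, mul_assoc 2, ENNReal.inv_mul_cancel hpB hpB',
        mul_one]

end Evidence

/-! ### Non-asymptotic posterior bound -/

section Rate

variable {𝕐 : Type*} [MeasurableSpace 𝕐] {μ : Measure 𝕐}

lemma exists_finset_cover (fstar f₀ : Density μ) {δ : ℝ≥0} {A : Set (Density μ)}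
    (hN : hellingerStarCoveringNumber fstar f₀ δ A ≠ ⊤) :
    ∃ T : Finset (Density μ), (T.card : ℕ∞) ≤ hellingerStarCoveringNumber fstar f₀ δ A ∧
      ∀ f ∈ A, ∃ g ∈ T, hellingerStar fstar f₀ f g ≤ δ := by
  let := hellingerStarSpace fstar f₀
  have hlt : hellingerStarCoveringNumber fstar f₀ δ A
      < hellingerStarCoveringNumber fstar f₀ δ A + 1 := ENat.lt_add_one_iff hN |>.2 le_rfl
  nth_rewrite 1 [hellingerStarCoveringNumber, Metric.externalCoveringNumber] at hlt
  simp only [iInf_lt_iff] at hlt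
  obtain ⟨T, hT, hcard⟩ := hlt
  have hcard' := (ENat.lt_add_one_iff hN).1 hcard
  have hfin : T.Finite := Set.encard_ne_top_iff.1 (ne_top_of_le_ne_top hN hcard')
  refine ⟨hfin.toFinset, ?_, fun f hf => ?_⟩
  · rwa [← hfin.encard_eq_coe_toFinset_card]
  · obtain ⟨g, hg, hfg⟩ := hT hf
    exact ⟨g, hfin.mem_toFinset.2 hg, hfg⟩

lemma div_le_sqrt_div {a b l : ℝ≥0∞} (hab : a ≤ b) (hl : l ≤ b) :
    a / b ≤ a ^ (1 / 2 : ℝ) / l ^ (1 / 2 : ℝ) := by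
  have h1 : a / b ≤ 1 := ENNReal.div_le_of_le_mul (by simpa using hab)
  calc a / b = (a / b) ^ (1 : ℝ) := (ENNReal.rpow_one _).symm
    _ ≤ (a / b) ^ (1 / 2 : ℝ) := ENNReal.rpow_le_rpow_of_exponent_ge h1 (by norm_num)
    _ = a ^ (1 / 2 : ℝ) / b ^ (1 / 2 : ℝ) := ENNReal.div_rpow_of_nonneg _ _ (by norm_num)
    _ ≤ _ := by gcongr

variable {Ω : Type*} [MeasurableSpace Ω] {P : Measure Ω} [IsProbabilityMeasure P]

/-- The non-asymptotic bound. Outside the event that the evidence is below `l`, the posterior mass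
of `{H* ≥ d + 2 δ}` is at most `l^{-1/2}` times the sum of the square roots of the integrated
likelihoods of the complement of the sieve and of the covering balls. -/
lemma measure_posterior_ge_le [SFinite μ] {F : Set (Density μ)} [MeasurableSpace F]
    (hF : Measurable fun q : F × 𝕐 => q.1.1.pdf q.2) (hconv : IsMixtureConvex F)
    {fstar f₀ : Density μ} (hf₀ : IsKLMinimizer fstar F f₀)
    (prior : Measure F) [IsProbabilityMeasure prior]
    {Y : ℕ → Ω → 𝕐} (hY : ∀ i, Measurable (Y i))
    (hindep : iIndepFun Y P) (hlaw : ∀ i, P.map (Y i) = fstar.law) (n : ℕ)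
    {d δ : ℝ} (hd : 0 ≤ d) (hδ : 0 ≤ δ) {S : Set F}
    (hN : hellingerStarCoveringNumber fstar f₀ δ.toNNReal (Subtype.val '' S) ≠ ⊤)
    {κ l : ℝ≥0∞} (hκ0 : κ ≠ 0) (hκ : κ ≠ ∞) (hl0 : l ≠ 0) (hl : l ≠ ∞) :
    P {ω | κ ≤ posterior prior f₀ n (fun i => Y i ω)
          {f : F | ENNReal.ofReal (d + 2 * δ) ≤ hellingerStar fstar f₀ f₀ f.1}} ≤
      P {ω | ∫⁻ f : F, (likelihoodRatio f₀ f.1 n (fun i => Y i ω) : ℝ≥0∞) ∂prior < l} +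
      (prior Sᶜ ^ (1 / 2 : ℝ) +
        (hellingerStarCoveringNumber fstar f₀ δ.toNNReal (Subtype.val '' S) : ℝ≥0∞)
          * ENNReal.ofReal (Real.exp (-(d ^ 2 / 2))) ^ n) / (κ * l ^ (1 / 2 : ℝ)) := by
  obtain ⟨T, hTcard, hT⟩ := exists_finset_cover fstar f₀ hN
  let ball : Density μ → Set F := fun g => {f : F | hellingerStar fstar f₀ f.1 g ≤ ENNReal.ofReal δ ∧
    ENNReal.ofReal (d + 2 * δ) ≤ hellingerStar fstar f₀ f₀ f.1}
  let I : Set F → Ω → ℝ≥0∞ := fun A ω =>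
    ∫⁻ f in A, (likelihoodRatio f₀ f.1 n (fun i => Y i ω) : ℝ≥0∞) ∂prior
  have hI : ∀ A, Measurable (I A) := fun A =>
    measurable_lintegral_likelihoodRatio hF f₀ hY n (prior.restrict A)
  let W : Ω → ℝ≥0∞ := fun ω => I Sᶜ ω ^ (1 / 2 : ℝ) + ∑ g ∈ T, I (ball g) ω ^ (1 / 2 : ℝ)
  have hWm : Measurable W := ((hI _).pow_const _).add
    (Finset.measurable_sum _ fun g _ => (hI _).pow_const _)
  have hW : ∫⁻ ω, W ω ∂P ≤ prior Sᶜ ^ (1 / 2 : ℝ) +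
      (hellingerStarCoveringNumber fstar f₀ δ.toNNReal (Subtype.val '' S) : ℝ≥0∞)
        * ENNReal.ofReal (Real.exp (-(d ^ 2 / 2))) ^ n := by
    rw [lintegral_add_left ((hI _).pow_const _),
      lintegral_finsetSum _ fun g _ => (hI _).pow_const _]
    gcongr ?_ + ?_
    · have h := lintegral_sqrt_lintegral_likelihoodRatio_le hF hconv (S := Set.univ) one_ne_zero
        (fun Φ _ _ h hh _ => lintegral_sqrt_div_le_one hF hconv hf₀ hh) (prior.restrict Sᶜ)
        (by simp) hY hindep hlaw n
      simpa using h
    · calc _ ≤ ∑ g ∈ T, ENNReal.ofReal (Real.exp (-(d ^ 2 / 2))) ^ n :=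
            Finset.sum_le_sum fun g _ => lintegral_sqrt_likelihoodRatio_ball_le hF hconv hf₀ g hd hδ
              prior hY hindep hlaw n
        _ = (T.card : ℝ≥0∞) * ENNReal.ofReal (Real.exp (-(d ^ 2 / 2))) ^ n := by simp
        _ ≤ _ := by
            gcongr
            exact_mod_cast ENat.toENNReal_le.2 hTcard
  have hsub : {ω | κ ≤ posterior prior f₀ n (fun i => Y i ω)
          {f : F | ENNReal.ofReal (d + 2 * δ) ≤ hellingerStar fstar f₀ f₀ f.1}} ⊆
      {ω | ∫⁻ f : F, (likelihoodRatio f₀ f.1 n (fun i => Y i ω) : ℝ≥0∞) ∂prior < l} ∪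
      {ω | κ * l ^ (1 / 2 : ℝ) ≤ W ω} := by
    intro ω hω
    rw [Set.mem_ofPred_eq] at hω
    refine or_iff_not_imp_left.2 fun hden => ?_
    rw [Set.mem_ofPred_eq, not_lt] at hden
    rw [Set.mem_ofPred_eq]
    have hl' : l ^ (1 / 2 : ℝ) ≠ 0 := by simp [ENNReal.rpow_eq_zero_iff, hl0, hl]
    have hl'' : l ^ (1 / 2 : ℝ) ≠ ∞ := by finiteness
    rw [← ENNReal.le_div_iff_mul_le (Or.inl hl') (Or.inl hl'')]
    refine hω.trans ?_
    have hcover : {f : F | ENNReal.ofReal (d + 2 * δ) ≤ hellingerStar fstar f₀ f₀ f.1} ⊆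
        Sᶜ ∪ ⋃ g : T, ball g := by
      intro f hf
      by_cases hfS : f ∈ S
      · obtain ⟨g, hg, hfg⟩ := hT f.1 ⟨f, hfS, rfl⟩
        exact Or.inr (Set.mem_iUnion.2 ⟨⟨g, hg⟩, hfg, hf⟩)
      · exact Or.inl hfS
    have hnum : I {f : F | ENNReal.ofReal (d + 2 * δ) ≤ hellingerStar fstar f₀ f₀ f.1} ω ≤
        I Sᶜ ω + ∑ g ∈ T, I (ball g) ω := by
      refine (lintegral_mono_set hcover).trans ((lintegral_union_le _ _ _).trans ?_)
      gcongr
      refine (lintegral_iUnion_le _ _).trans_eq ?_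
      rw [tsum_fintype]
      exact Finset.sum_coe_sort T fun g => I (ball g) ω
    have hpart : ∀ A, I A ω ≤ ∫⁻ f : F, (likelihoodRatio f₀ f.1 n (fun i => Y i ω) : ℝ≥0∞) ∂prior :=
      fun A => setLIntegral_le_lintegral _ _
    calc _ ≤ (I Sᶜ ω + ∑ g ∈ T, I (ball g) ω) /
            ∫⁻ f : F, (likelihoodRatio f₀ f.1 n (fun i => Y i ω) : ℝ≥0∞) ∂prior :=
          ENNReal.div_le_div_right hnum _
      _ ≤ W ω / l ^ (1 / 2 : ℝ) := by
          simp only [W, div_eq_mul_inv, add_mul, Finset.sum_mul]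
          simp only [← div_eq_mul_inv]
          exact add_le_add (div_le_sqrt_div (hpart _) hden)
            (Finset.sum_le_sum fun g _ => div_le_sqrt_div (hpart _) hden)
  refine (measure_mono hsub).trans ((measure_union_le _ _).trans ?_)
  gcongr
  refine (meas_ge_le_lintegral_div hWm.aemeasurable ?_ (by finiteness)).trans ?_
  · simp [ENNReal.rpow_eq_zero_iff, hl0, hl, hκ0]
  · gcongr

end Rate

/-! ### Rates as exponentials, and the limit -/

section Exponentials

lemma ofReal_exp_mul (x y : ℝ) : ENNReal.ofReal (Real.exp x) * ENNReal.ofReal (Real.exp y) =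
    ENNReal.ofReal (Real.exp (x + y)) := by
  rw [← ENNReal.ofReal_mul (Real.exp_nonneg _), Real.exp_add]

lemma ofReal_exp_rpow_half (x : ℝ) : ENNReal.ofReal (Real.exp x) ^ (1 / 2 : ℝ) =
    ENNReal.ofReal (Real.exp (x / 2)) := by
  rw [ENNReal.ofReal_rpow_of_pos (Real.exp_pos _), ← Real.exp_mul]
  ring_nf

lemma ofReal_exp_pow (x : ℝ) (n : ℕ) : ENNReal.ofReal (Real.exp x) ^ n =
    ENNReal.ofReal (Real.exp (n * x)) := by
  rw [← ENNReal.ofReal_pow (Real.exp_nonneg _), Real.exp_nat_mul]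

lemma tendsto_ofReal_exp_neg_mul {a : ℕ → ℝ} (ha : Tendsto a atTop atTop) {c : ℝ} (hc : 0 < c) :
    Tendsto (fun n => ENNReal.ofReal (Real.exp (-(c * a n)))) atTop (𝓝 0) := by
  rw [← ENNReal.ofReal_zero]
  exact ENNReal.tendsto_ofReal (Real.tendsto_exp_neg_atTop_nhds_zero.comp (ha.const_mul_atTop hc))

end Exponentials

end Misspecified

/-- Posterior convergence rate in the misspecified iid model. The constant `M` depends only on
the thickness constant `C` and the entropy constant `R`. -/
theorem theorem3 (C R : ℝ) (hC : 0 < C) :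
    ∃ M : ℝ, 0 < M ∧
      ∀ (𝕐 : Type*) [TopologicalSpace 𝕐] [PolishSpace 𝕐] [MeasurableSpace 𝕐] [BorelSpace 𝕐]
        (μ : Measure 𝕐) [SigmaFinite μ]
        -- the true density, the model with its sigma-algebra, and the prior
        (fstar : Misspecified.Density μ)
        (F : Set (Misspecified.Density μ)) [MeasurableSpace F]
        (_hF : Measurable fun q : F × 𝕐 => q.1.1.pdf q.2)
        (_hconv : Misspecified.IsMixtureConvex F)
        (prior : Measure F) [IsProbabilityMeasure prior]
        -- the Kullback--Leibler minimiser
        (f₀ : Misspecified.Density μ) (_hf₀ : Misspecified.IsKLMinimizer fstar F f₀)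
        -- the data: an iid sequence with density `fstar`
        (Ω : Type*) [MeasurableSpace Ω] (P : Measure Ω) [IsProbabilityMeasure P]
        (Y : ℕ → Ω → 𝕐) (_hY : ∀ i, Measurable (Y i)) (_hindep : iIndepFun Y P)
        (_hlaw : ∀ i, P.map (Y i) = fstar.law)
        -- the rate and the thickness of the prior
        (ε : ℕ → ℝ) (_hεpos : ∀ n, 0 < ε n) (_hε : Tendsto ε atTop (𝓝 0))
        (_hnε : Tendsto (fun n : ℕ => (n : ℝ) * ε n ^ 2) atTop atTop)
        (_hthick : Misspecified.IsThick prior fstar f₀ ε C)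
        -- the sieve
        (Fn : ℕ → Set F) (_hFn : ∀ n, MeasurableSet (Fn n))
        (r : ℝ) (_hr : C + 1 < r)
        (_hmass : ∃ D : ℝ, ∀ᶠ n : ℕ in atTop,
          prior.real (Fn n)ᶜ ≤ D * Real.exp (-r * (n * ε n ^ 2)))
        (_hentropy : ∀ᶠ n : ℕ in atTop,
          ENNReal.log ((Misspecified.hellingerStarCoveringNumber fstar f₀ (ε n).toNNReal
            (Subtype.val '' Fn n) : ℕ∞) : ℝ≥0∞) ≤ ((R * (n * ε n ^ 2) : ℝ) : EReal)),
        TendstoInMeasure P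
          (fun (n : ℕ) (ω : Ω) =>
            (Misspecified.posterior prior f₀ n (fun i => Y i ω)
              {f : F | ENNReal.ofReal (M * ε n)
                ≤ Misspecified.hellingerStar fstar f₀ f₀ f.1}).toReal)
          atTop (fun _ => 0) := by
  -- With `s = M - 2`, the balls contribute `exp ((R + (1 + c + C) / 2 - s² / 2) n ε²)`, where
  -- `c ≤ 1`; since `s ≥ 2`, `s² / 2 ≥ s = |R| + C + 2` makes the exponent at most `-n ε²`.
  obtain ⟨s, hs⟩ : ∃ s : ℝ, s = |R| + C + 2 := ⟨_, rfl⟩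
  have hR0 := abs_nonneg R
  have hRle := le_abs_self R
  refine ⟨s + 2, by linarith, ?_⟩
  intro 𝕐 _ _ _ _ μ _ fstar F _ hF hconv prior _ f₀ hf₀ Ω _ P _ Y hY hindep hlaw ε hεpos _ hnε
    hthick Fn _ r hr ⟨D, hmass⟩ hentropy
  obtain ⟨c, hc0, hc1, hcr⟩ : ∃ c : ℝ, 0 < c ∧ c ≤ 1 ∧ 2 * c ≤ r - C - 1 :=
    ⟨min 1 ((r - C - 1) / 2), lt_min one_pos (by linarith), min_le_left _ _, by
      linarith [min_le_right 1 ((r - C - 1) / 2)]⟩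
  let a : ℕ → ℝ := fun n => n * ε n ^ 2
  let K : ℝ → ℝ≥0∞ := fun x => ENNReal.ofReal (Real.exp x)
  have hK0 : ∀ x, K x ≠ 0 := fun x => by simp [K, Real.exp_pos]
  have hKtop : ∀ x, K x ≠ ∞ := fun x => ENNReal.ofReal_ne_top
  let l : ℕ → ℝ≥0∞ := fun n => K (-((1 + c) * a n)) * (K (-C * a n) / 2)
  intro κ hκ0
  wlog hκ : κ ≠ ∞ generalizing κ
  · refine tendsto_of_tendsto_of_tendsto_of_le_of_le tendsto_const_nhds
      (this 1 one_pos ENNReal.one_ne_top) (fun _ => zero_le) fun n => measure_mono fun ω hω => ?_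
    rw [not_not] at hκ
    rw [Set.mem_ofPred_eq, hκ] at hω
    exact le_top.trans hω
  let bound : ℕ → ℝ≥0∞ := fun n => 2 * ENNReal.ofReal (1 / (c ^ 2 * a n)) +
    (ENNReal.ofReal D ^ (1 / 2 : ℝ) * K (-(c / 2 * a n)) + K (-(1 * a n))) /
      (κ * (2⁻¹ : ℝ≥0∞) ^ (1 / 2 : ℝ))
  have hq0 : (2⁻¹ : ℝ≥0∞) ^ (1 / 2 : ℝ) ≠ 0 := by simp [ENNReal.rpow_eq_zero_iff]
  have hbound : Tendsto bound atTop (𝓝 0) := by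
    have h1 : Tendsto (fun n => 2 * ENNReal.ofReal (1 / (c ^ 2 * a n))) atTop (𝓝 0) := by
      have : Tendsto (fun n => 1 / (c ^ 2 * a n)) atTop (𝓝 0) := by
        simp only [one_div]
        exact (hnε.const_mul_atTop (pow_pos hc0 2)).inv_tendsto_atTop
      simpa using ENNReal.Tendsto.const_mul (ENNReal.tendsto_ofReal this)
        (Or.inr (ENNReal.ofNat_ne_top (n := 2)))
    have h2 : Tendsto (fun n => ENNReal.ofReal D ^ (1 / 2 : ℝ) * K (-(c / 2 * a n)) +
        K (-(1 * a n))) atTop (𝓝 0) := by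
      have hD : ENNReal.ofReal D ^ (1 / 2 : ℝ) ≠ ∞ := by finiteness
      simpa using (ENNReal.Tendsto.const_mul
        (Misspecified.tendsto_ofReal_exp_neg_mul hnε (half_pos hc0)) (Or.inr hD)).add
        (Misspecified.tendsto_ofReal_exp_neg_mul hnε one_pos)
    have h3 := ENNReal.Tendsto.div_const h2 (b := κ * (2⁻¹ : ℝ≥0∞) ^ (1 / 2 : ℝ))
      (Or.inr (mul_ne_zero hκ0.ne' hq0))
    rw [ENNReal.zero_div] at h3
    have h4 := h1.add h3
    rwa [add_zero] at h4
  refine tendsto_of_tendsto_of_tendsto_of_le_of_le' tendsto_const_nhds hbound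
    (Eventually.of_forall fun _ => zero_le) ?_
  filter_upwards [hthick, hmass, hentropy, eventually_gt_atTop 0] with n hthick hmass hentropy hn
  have ha : 0 < a n := by
    have := hεpos n
    positivity
  have hev : P {ω | ∫⁻ f : F, (Misspecified.likelihoodRatio f₀ f.1 n (fun i => Y i ω) : ℝ≥0∞) ∂prior
      < l n} ≤ 2 * ENNReal.ofReal (1 / (c ^ 2 * a n)) :=
    Misspecified.measure_evidence_lt_le hF hf₀.2.1 prior (pow_pos (hεpos n) 2) (hK0 _) hthick
      hY hindep hlaw hc0 hn
  -- the covering number, the mass outside the sieve and the lower bound `l` as exponentials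
  have hNle : ((Misspecified.hellingerStarCoveringNumber fstar f₀ (ε n).toNNReal
      (Subtype.val '' Fn n) : ℕ∞) : ℝ≥0∞) ≤ K (R * a n) := by
    rw [← ENNReal.log_le_log_iff, ENNReal.log_ofReal_of_pos (Real.exp_pos _), Real.log_exp]
    exact hentropy
  have hN : Misspecified.hellingerStarCoveringNumber fstar f₀ (ε n).toNNReal
      (Subtype.val '' Fn n) ≠ ⊤ := by
    intro h
    rw [h] at hNle
    exact hKtop _ (top_le_iff.1 (by simpa using hNle))
  have hmass' : prior (Fn n)ᶜ ^ (1 / 2 : ℝ) ≤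
      ENNReal.ofReal D ^ (1 / 2 : ℝ) * K (-(r * a n) / 2) := by
    have h : prior (Fn n)ᶜ ≤ ENNReal.ofReal D * K (-(r * a n)) := by
      rw [← ofReal_measureReal, ← ENNReal.ofReal_mul' (Real.exp_nonneg _)]
      refine ENNReal.ofReal_le_ofReal ?_
      rwa [← neg_mul]
    refine (ENNReal.rpow_le_rpow h (by norm_num)).trans_eq ?_
    rw [ENNReal.mul_rpow_of_nonneg _ _ (by norm_num), Misspecified.ofReal_exp_rpow_half]
  have hl : l n ^ (1 / 2 : ℝ) = (2⁻¹ : ℝ≥0∞) ^ (1 / 2 : ℝ) * K (-((1 + c + C) * a n / 2)) := by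
    have : l n = 2⁻¹ * K (-((1 + c + C) * a n)) := by
      simp only [l, K]
      rw [ENNReal.div_eq_inv_mul, mul_left_comm, Misspecified.ofReal_exp_mul]
      ring_nf
    rw [this, ENNReal.mul_rpow_of_nonneg _ _ (by norm_num), Misspecified.ofReal_exp_rpow_half,
      neg_div]
  have hl0 : l n ≠ 0 :=
    mul_ne_zero (hK0 _) (ENNReal.div_ne_zero.2 ⟨hK0 _, ENNReal.ofNat_ne_top⟩)
  have hltop : l n ≠ ∞ := ENNReal.mul_ne_top (hKtop _) (ENNReal.div_ne_top (hKtop _) two_ne_zero)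
  have hnum : prior (Fn n)ᶜ ^ (1 / 2 : ℝ) +
      ((Misspecified.hellingerStarCoveringNumber fstar f₀ (ε n).toNNReal
        (Subtype.val '' Fn n) : ℕ∞) : ℝ≥0∞)
          * ENNReal.ofReal (Real.exp (-((s * ε n) ^ 2 / 2))) ^ n ≤
      (ENNReal.ofReal D ^ (1 / 2 : ℝ) * K (-(c / 2 * a n)) + K (-(1 * a n))) *
        K (-((1 + c + C) * a n / 2)) := by
    rw [add_mul, mul_assoc, Misspecified.ofReal_exp_mul, Misspecified.ofReal_exp_mul,
      Misspecified.ofReal_exp_pow]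
    refine add_le_add (hmass'.trans ?_) ((mul_le_mul_left hNle _).trans ?_)
    · gcongr
      refine ENNReal.ofReal_le_ofReal (Real.exp_le_exp.2 ?_)
      nlinarith
    · rw [Misspecified.ofReal_exp_mul]
      refine ENNReal.ofReal_le_ofReal (Real.exp_le_exp.2 ?_)
      have h1 : (n : ℝ) * -((s * ε n) ^ 2 / 2) = -(s ^ 2 / 2) * a n := by
        simp only [a]
        ring
      have h2 : R - s ^ 2 / 2 ≤ -1 - (1 + c + C) / 2 := by nlinarith
      rw [h1]
      nlinarith
  have hmain := Misspecified.measure_posterior_ge_le hF hconv hf₀ prior hY hindep hlaw n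
    (d := s * ε n) (δ := ε n) (mul_nonneg (by linarith) (hεpos n).le) (hεpos n).le (S := Fn n)
    hN hκ0.ne' hκ hl0 hltop
  rw [← add_mul] at hmain
  refine (measure_mono fun ω hω => ?_).trans (hmain.trans (add_le_add hev ?_))
  · rw [Set.mem_ofPred_eq] at hω ⊢
    refine hω.trans ?_
    rw [edist_zero_right, Real.enorm_of_nonneg ENNReal.toReal_nonneg]
    exact ENNReal.ofReal_toReal_le
  · rw [hl, ← mul_assoc]
    refine (ENNReal.div_le_div_right hnum _).trans_eq ?_
    exact ENNReal.mul_div_mul_right _ _ (hK0 _) (hKtop _)
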